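/- **Theorem 6.1.** All superalgebras are over $\mathbb C$ and finite-dimensional, and isomorphisms respect the $\mathbb Z_2$-grading. A *Leibniz superalgebra* is a $\mathbb Z_2$-graded vector space $L=L_{\bar 0}\oplus L_{\bar 1}$ with an even bilinear product satisfying $[x,[y,z]]=[[x,y],z]-(-1)^{|y||z|}[[x,z],y]$ for all $x\in L$ and homogeneous $y,z\in L$. $L$ is *solvable* if the sequence $\mathcal D^0=L$, $\mathcal D^{r+1}=[\mathcal D^r,\mathcal D^r]$ reaches $0$; a subalgebra $S$ is *nilpotent* if the sequence $\mathcal C^0=S$, $\mathcal C^{r+1}=[\mathcal C^r,S]$ reaches $0$; the *nilradical* of $L$ is its largest nilpotent (graded, two-sided) ideal; and $L^2=[L,L]$. Let $k,p\ge 1$ and let $n_1,\dots,n_k\ge 2$ and $m_1,\dots,m_p\ge 2$ be integers. Put $N_j=n_1+\dots+n_j$ and $M_j=m_1+\dots+m_j$ (so $N_0=M_0=0$). Let $NP(n_1,\dots,n_k,1\,|\,m_1,\dots,m_p)$ be the superalgebra with even basis $x_1,\dots,x_{N_k+1}$, odd basis $y_1,\dots,y_{M_p}$ and the only non-zero products $$\begin{array}{ll}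 [x_{N_j+i},x_1]=x_{N_j+i+1}, & 0\le j\le k-1,\ 2\le i\le n_{j+1},\\ [y_{M_j+i},x_1]=y_{M_j+i+1}, & 0\le j\le p-1,\ 1\le i\le m_{j+1}-1. \end{array}$$ Let $SNP(n_1,\dots,n_k,1\,|\,m_1,\dots,m_p)$ be the superalgebra with even basis $x_1,\dots,x_{N_k+1},t_1,\dots,t_{k+1},t'_1,\dots,t'_p$, odd basis $y_1,\dots,y_{M_p}$ and the only non-zero products $$\begin{array}{ll} [x_{N_j+i},x_1]=x_{N_j+i+1}, & 0\le j\le k-1,\ 2\le i\le n_{j+1},\\ [y_{M_j+i},x_1]=y_{M_j+i+1}, & 0\le j\le p-1,\ 1\le i\le m_{j+1}-1,\\ [t_1,x_1]=-x_1,\qquad [x_1,t_1]=x_1, & \\ [x_{N_j+i},t_1]=(i-2)\,x_{N_j+i}, & 0\le j\le k-1,\ 3\le i\le n_{j+1}+1,\\ [y_{M_j+i},t_1]=(i-1)\,y_{M_j+i}, & 0\le j\le p-1,\ 2\le i\le m_{j+1},\\ [x_{N_j+i},t_{j+2}]=x_{N_j+i}, & 0\le j\le k-1,\ 2\le i\le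 n_{j+1}+1,\\ [y_{M_j+i},t'_{j+1}]=y_{M_j+i}, & 0\le j\le p-1,\ 1\le i\le m_{j+1}. \end{array}$$ Let $L$ be a solvable Leibniz superalgebra such that $L^2$ is nilpotent and the nilradical of $L$ is isomorphic to $NP(n_1,\dots,n_k,1\,|\,m_1,\dots,m_p)$, and suppose that $L$ has the largest dimension among all superalgebras with these properties. Then $L$ is isomorphic to $SNP(n_1,\dots,n_k,1\,|\,m_1,\dots,m_p)$. -/

import Mathlib

universe u v

/-- A complex superalgebra with underlying vector space `V`: a decomposition of `V` as the direct
sum of its even part `part 0` and its odd part `part 1`, and an even bilinear product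
`bracket x y = [x, y]`. No identity is imposed on the product here. -/
structure ComplexSuperalgebra (V : Type u) [AddCommGroup V] [Module ℂ V] where
  part : ZMod 2 → Submodule ℂ V
  isInternal : DirectSum.IsInternal part
  bracket : V →ₗ[ℂ] V →ₗ[ℂ] V
  bracket_mem : ∀ i j : ZMod 2, ∀ x ∈ part i, ∀ y ∈ part j, bracket x y ∈ part (i + j)

namespace ComplexSuperalgebra

variable {V : Type u} [AddCommGroup V] [Module ℂ V] {W : Type v} [AddCommGroup W] [Module ℂ W]

/-- The super Leibniz identity `[x,[y,z]] = [[x,y],z] - (-1)^{|y||z|} [[x,z],y]`,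
for arbitrary `x` and homogeneous `y`, `z`. -/
def IsLeibniz (L : ComplexSuperalgebra V) : Prop :=
  ∀ i j : ZMod 2, ∀ x : V, ∀ y ∈ L.part i, ∀ z ∈ L.part j,
    L.bracket x (L.bracket y z) =
      L.bracket (L.bracket x y) z
        - (-1 : ℂ) ^ (i.val * j.val) • L.bracket (L.bracket x z) y

/-- `[A, B]`: the span of all products `[a, b]` with `a ∈ A`, `b ∈ B`. -/
def bracketSpan (L : ComplexSuperalgebra V) (A B : Submodule ℂ V) : Submodule ℂ V :=
  Submodule.map₂ L.bracket A B

/-- The square `L² = [L, L]`. -/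
def square (L : ComplexSuperalgebra V) : Submodule ℂ V := L.bracketSpan ⊤ ⊤

/-- The derived sequence `D⁰ = L`, `D^{r+1} = [D^r, D^r]`. -/
def derivedSeq (L : ComplexSuperalgebra V) : ℕ → Submodule ℂ V
  | 0 => ⊤
  | r + 1 => L.bracketSpan (L.derivedSeq r) (L.derivedSeq r)

def IsSolvable (L : ComplexSuperalgebra V) : Prop := ∃ r, L.derivedSeq r = ⊥

/-- The descending central sequence `C⁰ = S`, `C^{r+1} = [C^r, S]` of a subalgebra `S`. -/
def centralSeq (L : ComplexSuperalgebra V) (S : Submodule ℂ V) : ℕ → Submodule ℂ V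
  | 0 => S
  | r + 1 => L.bracketSpan (L.centralSeq S r) S

/-- Nilpotency of a subalgebra `S` of `L`, as an algebra in its own right. -/
def IsNilpotentSub (L : ComplexSuperalgebra V) (S : Submodule ℂ V) : Prop :=
  ∃ r, L.centralSeq S r = ⊥

/-- Two-sided graded ideals. -/
structure IsIdeal (L : ComplexSuperalgebra V) (I : Submodule ℂ V) : Prop where
  graded : I = (I ⊓ L.part 0) ⊔ (I ⊓ L.part 1)
  bracket_left : ∀ x ∈ I, ∀ y : V, L.bracket x y ∈ I
  bracket_right : ∀ x ∈ I, ∀ y : V, L.bracket y x ∈ I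

/-- `N` is the nilradical of `L`: the largest nilpotent ideal. -/
structure IsNilradical (L : ComplexSuperalgebra V) (N : Submodule ℂ V) : Prop where
  isIdeal : L.IsIdeal N
  nilpotent : L.IsNilpotentSub N
  largest : ∀ I : Submodule ℂ V, L.IsIdeal I → L.IsNilpotentSub I → I ≤ N

/-- Homomorphisms of superalgebras: linear maps that respect the grading and the product. -/
structure IsHom (A : ComplexSuperalgebra V) (B : ComplexSuperalgebra W) (f : V →ₗ[ℂ] W) :
    Prop where
  map_part : ∀ i : ZMod 2, ∀ x ∈ A.part i, f x ∈ B.part i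
  map_bracket : ∀ x y : V, f (A.bracket x y) = B.bracket (f x) (f y)

/-- Isomorphism of superalgebras (compatible with the grading). -/
def Isomorphic (A : ComplexSuperalgebra V) (B : ComplexSuperalgebra W) : Prop :=
  ∃ f : V ≃ₗ[ℂ] W, A.IsHom B f.toLinearMap

/-- The superalgebra `A` is isomorphic to the graded ideal `N` of `L`, regarded as a superalgebra:
there is an injective homomorphism `A → L` with image `N`. -/
def IsomorphicToSub (A : ComplexSuperalgebra V) (L : ComplexSuperalgebra W)
    (N : Submodule ℂ W) : Prop :=
  ∃ f : V →ₗ[ℂ] W, A.IsHom L f ∧ Function.Injective f ∧ LinearMap.range f = N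

/-- `L` is a finite-dimensional solvable Leibniz superalgebra with `L²` nilpotent whose nilradical
is isomorphic to `A`. -/
structure IsSolvableWithNilradical (L : ComplexSuperalgebra V) (A : ComplexSuperalgebra W) :
    Prop where
  finite : FiniteDimensional ℂ V
  leibniz : L.IsLeibniz
  solvable : L.IsSolvable
  square_nilpotent : L.IsNilpotentSub L.square
  nilradical : ∃ N : Submodule ℂ V, L.IsNilradical N ∧ A.IsomorphicToSub L N

/-- `L` has the largest dimension among all finite-dimensional solvable Leibniz superalgebras `M`
with `M²` nilpotent and nilradical isomorphic to `A`. -/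
def IsMaximalSolvableWithNilradical (L : ComplexSuperalgebra V) (A : ComplexSuperalgebra W) :
    Prop :=
  L.IsSolvableWithNilradical A ∧
    ∀ (V' : Type u) [AddCommGroup V'] [Module ℂ V'] (M : ComplexSuperalgebra V'),
      M.IsSolvableWithNilradical A → Module.finrank ℂ V' ≤ Module.finrank ℂ V

/-- The superalgebra with basis `ι`, parities `deg`, and the products `[a, b] = table a b` of
basis vectors. -/
noncomputable def ofTable {ι : Type u} (deg : ι → ZMod 2) (table : ι → ι → (ι →₀ ℂ))
    (h : ∀ a b, table a b ∈ Finsupp.supported ℂ ℂ {c | deg c = deg a + deg b}) :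
    ComplexSuperalgebra (ι →₀ ℂ) where
  part i := Finsupp.supported ℂ ℂ {c | deg c = i}
  isInternal := by
    rw [DirectSum.isInternal_submodule_iff_isCompl _ (i := 0) (j := 1) (by decide)
      (by
        have : ∀ i : ZMod 2, i = 0 ∨ i = 1 := by decide
        ext i
        simpa using this i)]
    constructor
    · apply Finsupp.disjoint_supported_supported
      rw [Set.disjoint_left]
      intro c hc hc'
      have h0 : deg c = 0 := hc
      have h1 : deg c = 1 := hc'
      rw [h0] at h1
      exact absurd h1 (by decide)
    · apply Finsupp.codisjoint_supported_supported
      rw [codisjoint_iff]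
      ext c
      have : ∀ i : ZMod 2, i = 0 ∨ i = 1 := by decide
      simpa using this (deg c)
  bracket := Finsupp.basisSingleOne.constr ℂ fun a => Finsupp.basisSingleOne.constr ℂ (table a)
  bracket_mem := by
    intro i j x hx y hy
    rw [Module.Basis.constr_apply, LinearMap.finsupp_sum_apply]
    refine Submodule.sum_mem _ fun a ha => ?_
    simp only [LinearMap.smul_apply, Module.Basis.constr_apply]
    refine Submodule.smul_mem _ _ (Submodule.sum_mem _ fun b hb => Submodule.smul_mem _ _ ?_)
    have ha' : deg a = i := hx (by simpa using ha)
    have hb' : deg b = j := hy (by simpa using hb)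
    have := h a b
    rwa [ha', hb'] at this

end ComplexSuperalgebra

/-- The basis of `NP(n₁,…,n_k,1 | m₁,…,m_p)`. With 0-based block numbers `j` and positions `i`,
`x1` is `x₁`, `x j i` is `x_{n₁+⋯+n_j+i+2}` (the `i`-th vector of the `j`-th even block, which has
`n j` vectors), and `y j i` is `y_{m₁+⋯+m_j+i+1}` (the `i`-th vector of the `j`-th odd block, which
has `m j` vectors). -/
inductive NPIndex {k p : ℕ} (n : Fin k → ℕ) (m : Fin p → ℕ) : Type
  | x1 : NPIndex n m
  | x (j : Fin k) (i : Fin (n j)) : NPIndex n m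
  | y (j : Fin p) (i : Fin (m j)) : NPIndex n m

namespace NPIndex

variable {k p : ℕ} {n : Fin k → ℕ} {m : Fin p → ℕ}

/-- The `x`'s are even, the `y`'s are odd. -/
def deg : NPIndex n m → ZMod 2
  | y _ _ => 1
  | _ => 0

/-- Right multiplication by `x₁` moves every vector of a block to the next vector of the same
block, and the last one to `0`; all other products vanish. -/
noncomputable def table : NPIndex n m → NPIndex n m → (NPIndex n m →₀ ℂ)
  | x j i, x1 => if h : i.val + 1 < n j then Finsupp.single (x j ⟨i.val + 1, h⟩) 1 else 0
  | y j i, x1 => if h : i.val + 1 < m j then Finsupp.single (y j ⟨i.val + 1, h⟩) 1 else 0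
  | _, _ => 0

theorem table_mem (a b : NPIndex n m) :
    table a b ∈ Finsupp.supported ℂ ℂ {c | deg c = deg a + deg b} := by
  cases a <;> cases b <;> simp only [table] <;> try exact Submodule.zero_mem _
  all_goals
    split_ifs
    · exact Finsupp.single_mem_supported ℂ _ (by simp [deg])
    · exact Submodule.zero_mem _

end NPIndex

/-- The model nilpotent non-Lie Leibniz superalgebra `NP(n₁,…,n_k,1 | m₁,…,m_p)`. -/
noncomputable def NP {k p : ℕ} (n : Fin k → ℕ) (m : Fin p → ℕ) :
    ComplexSuperalgebra (NPIndex n m →₀ ℂ) :=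
  ComplexSuperalgebra.ofTable NPIndex.deg NPIndex.table NPIndex.table_mem

/-- The basis of `SNP(n₁,…,n_k,1 | m₁,…,m_p)`: the basis of `NP(n₁,…,n_k,1 | m₁,…,m_p)`, the vector
`t1 = t₁`, the vectors `t j = t_{j+2}` for the even blocks, and the vectors `t' j = t'_{j+1}` for
the odd blocks (with 0-based `j`). -/
inductive SNPIndex {k p : ℕ} (n : Fin k → ℕ) (m : Fin p → ℕ) : Type
  | x1 : SNPIndex n m
  | x (j : Fin k) (i : Fin (n j)) : SNPIndex n m
  | t1 : SNPIndex n m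
  | t (j : Fin k) : SNPIndex n m
  | t' (j : Fin p) : SNPIndex n m
  | y (j : Fin p) (i : Fin (m j)) : SNPIndex n m

namespace SNPIndex

variable {k p : ℕ} {n : Fin k → ℕ} {m : Fin p → ℕ}

/-- The `x`'s, `t`'s and `t'`'s are even, the `y`'s are odd. -/
def deg : SNPIndex n m → ZMod 2
  | y _ _ => 1
  | _ => 0

/-- The products of basis vectors of `SNP(n₁,…,n_k,1 | m₁,…,m_p)`; omitted products are zero. -/
noncomputable def table : SNPIndex n m → SNPIndex n m → (SNPIndex n m →₀ ℂ)
  | x j i, x1 => if h : i.val + 1 < n j then Finsupp.single (x j ⟨i.val + 1, h⟩) 1 else 0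
  | y j i, x1 => if h : i.val + 1 < m j then Finsupp.single (y j ⟨i.val + 1, h⟩) 1 else 0
  | t1, x1 => Finsupp.single x1 (-1)
  | x1, t1 => Finsupp.single x1 1
  | x j i, t1 => Finsupp.single (x j i) (i.val : ℂ)
  | y j i, t1 => Finsupp.single (y j i) (i.val : ℂ)
  | x j i, t j' => if j' = j then Finsupp.single (x j i) 1 else 0
  | y j i, t' j' => if j' = j then Finsupp.single (y j i) 1 else 0
  | _, _ => 0

theorem table_mem (a b : SNPIndex n m) :
    table a b ∈ Finsupp.supported ℂ ℂ {c | deg c = deg a + deg b} := by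
  cases a <;> cases b <;> simp only [table] <;> try exact Submodule.zero_mem _
  all_goals
    first
    | exact Finsupp.single_mem_supported ℂ _ (by simp [deg])
    | split_ifs
      · exact Finsupp.single_mem_supported ℂ _ (by simp [deg])
      · exact Submodule.zero_mem _

end SNPIndex

/-- The solvable Leibniz superalgebra `SNP(n₁,…,n_k,1 | m₁,…,m_p)`. -/
noncomputable def SNP {k p : ℕ} (n : Fin k → ℕ) (m : Fin p → ℕ) :
    ComplexSuperalgebra (SNPIndex n m →₀ ℂ) :=
  ComplexSuperalgebra.ofTable SNPIndex.deg SNPIndex.table SNPIndex.table_mem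

/-! Since L² is a nilpotent ideal, it lies in the nilradical N, so every product of L lands in N.
Inside N a single operator matters: [u,v] = κ(v)[u,x₁], where κ reads the coefficient of x₁
(`IsNPFrame.bracket_eq`). For even a, let D be right multiplication by a and R right multiplication
by x₁. The Leibniz identity gives DR = RD + κ([x₁,a])R on N, and it makes the even elements act on
the blocks modulo [N,x₁] by commuting operators. Simultaneous triangularization
(`exists_linear_eigenvalues`) therefore attaches to a, linearly, 1+k+p weights: one on x₁ and one
per block. An even element whose weights all vanish lies in N (`IsNPFrame.mem_of_isNilpotent`), and
odd elements always do (`IsNPFrame.odd_le`). Hence the codimension of N is at most 1+k+p. The model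
SNP satisfies the hypotheses and reaches this bound, so for a maximal L the weight map is onto.

Surjectivity yields an even t of weight 1 on x₁ with freely prescribed block weights. As R raises
D-eigenvalues by 1, generalized eigenvectors lifted from the quotient by [N,x₁] generate chains
whose eigenvalues are all distinct, so the chains consist of genuine eigenvectors; the ranks of the
powers of R show that their lengths are the old ones (`exists_chain_eigenbasis`). After a correction
of x₁, N has a basis with the NP products that is diagonal for t, with distinct nonzero eigenvalues
(`IsNPFrame.exists_eigenframe`).

The annihilator T = {u : [u,t] = 0} is then a complement of N. It is even, has zero product, and
acts diagonally on the new basis from both sides. Its right weights are determined by those on the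
generators; its left weights are minus the right one on x₁ and zero on the blocks. The generator
weights are injective on T, hence bijective by dimension, and the basis of T dual to them completes
the multiplication table of SNP. -/

open Module

/-! ### Commuting operators, linear weights and eigenvector coordinates -/

section LinearAlgebra

variable {U : Type*} [AddCommGroup U] [Module ℂ U]

/-- The space is the sum of the generalized eigenspaces, and only the one for 0 survives. This turns
vanishing weights into nilpotency. -/
theorem isNilpotent_of_forall_hasEigenvalue [FiniteDimensional ℂ U] (f : End ℂ U)
    (h : ∀ μ, f.HasEigenvalue μ → μ = 0) : IsNilpotent f := by
  have key : f.maxGenEigenspace 0 = ⊤ := by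
    rw [← Module.End.iSup_maxGenEigenspace_eq_top f]
    refine le_antisymm (le_iSup f.maxGenEigenspace 0) (iSup_le fun μ => ?_)
    by_cases hμ : μ = 0
    · rw [hμ]
    · have : ¬ f.HasUnifEigenvalue μ ⊤ := fun h' =>
        hμ (h μ ((Module.End.hasUnifEigenvalue_iff_hasUnifEigenvalue_one (by simp)).1 h'))
      rw [Module.End.HasUnifEigenvalue, not_not] at this
      rw [Module.End.maxGenEigenspace, this]
      exact bot_le
  refine ⟨finrank ℂ U, LinearMap.ext fun v => ?_⟩
  have hv : v ∈ f.maxGenEigenspace 0 := key ▸ Submodule.mem_top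
  rw [Module.End.maxGenEigenspace_eq_genEigenspace_finrank, Module.End.mem_genEigenspace_nat] at hv
  simpa using hv

theorem LinearMap.exists_eq_smul_of_forall {H W : Type*} [AddCommGroup H] [Module ℂ H]
    [AddCommGroup W] [Module ℂ W] (f : H →ₗ[ℂ] W) {w : W} (hw : w ≠ 0)
    (h : ∀ x, ∃ c : ℂ, f x = c • w) : ∃ χ : H →ₗ[ℂ] ℂ, ∀ x, f x = χ x • w := by
  choose χ hχ using h
  refine ⟨{ toFun := χ, map_add' := fun x y => ?_, map_smul' := fun c x => ?_ }, hχ⟩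
  · refine smul_left_injective ℂ hw ?_
    simp only [← hχ, map_add, add_smul]
  · refine smul_left_injective ℂ hw ?_
    simp only [← hχ, map_smul, smul_eq_mul, mul_smul, RingHom.id_apply]

/-- Either all operators are scalar, or one of them has a proper nonzero eigenspace, which the
others preserve, and induction on the dimension applies there. -/
theorem exists_common_eigenvector {H : Type*} (d : ℕ) :
    ∀ (U : Type*) [AddCommGroup U] [Module ℂ U] [FiniteDimensional ℂ U] [Nontrivial U]
      (_ : finrank ℂ U = d) (φ : H → End ℂ U) (_ : ∀ a b, Commute (φ a) (φ b)),
      ∃ v : U, v ≠ 0 ∧ ∃ χ : H → ℂ, ∀ a, φ a v = χ a • v := by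
  induction d using Nat.strong_induction_on with
  | _ d ih =>
    intro U _ _ _ _ hd φ hφ
    by_cases hs : ∀ a, ∃ c : ℂ, ∀ v, φ a v = c • v
    · choose c hc using hs
      obtain ⟨v, hv⟩ := exists_ne (0 : U)
      exact ⟨v, hv, c, fun a => hc a v⟩
    · push Not at hs
      obtain ⟨a, ha⟩ := hs
      obtain ⟨μ, hμ⟩ := Module.End.exists_eigenvalue (φ a)
      have hinv : ∀ b, ∀ x ∈ (φ a).eigenspace μ, φ b x ∈ (φ a).eigenspace μ := fun b x hx =>
        Module.End.mapsTo_genEigenspace_of_comm (hφ a b) μ 1 hx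
      have hlt : finrank ℂ ((φ a).eigenspace μ) < d := by
        rw [← hd]
        refine Submodule.finrank_lt fun htop => ?_
        obtain ⟨v, hv⟩ := ha μ
        exact hv (Module.End.mem_eigenspace_iff.1 (htop ▸ Submodule.mem_top))
      have : Nontrivial ((φ a).eigenspace μ) := Submodule.nontrivial_iff_ne_bot.2 hμ
      obtain ⟨v, hv, χ, hχ⟩ := ih _ hlt ((φ a).eigenspace μ) rfl
        (fun b => (φ b).restrict (hinv b)) (fun b c => by
          ext x
          simpa using congr($(hφ b c) x))
      refine ⟨v, by simpa using hv, χ, fun b => ?_⟩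
      simpa using congrArg Subtype.val (hχ b)

/-- Simultaneous triangularization: split off a common eigenvector and pass to the quotient. The
diagonal entries depend linearly on the operator because each is read off on one fixed vector. -/
theorem exists_linear_eigenvalues {H : Type*} [AddCommGroup H] [Module ℂ H] (d : ℕ) :
    ∀ (U : Type*) [AddCommGroup U] [Module ℂ U] [FiniteDimensional ℂ U]
      (_ : finrank ℂ U = d) (φ : H →ₗ[ℂ] End ℂ U) (_ : ∀ a b, Commute (φ a) (φ b)),
      ∃ χ : Fin d → (H →ₗ[ℂ] ℂ), ∀ a μ, (φ a).HasEigenvalue μ ↔ ∃ i, χ i a = μ := by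
  induction d with
  | zero =>
    intro U _ _ _ hd φ _
    have := Module.finrank_zero_iff.1 hd
    refine ⟨Fin.elim0, fun a μ => ⟨fun h => ?_, fun ⟨i, _⟩ => i.elim0⟩⟩
    obtain ⟨v, hv⟩ := h.exists_hasEigenvector
    exact absurd (Subsingleton.elim v 0) hv.2
  | succ d ih =>
    intro U _ _ _ hd φ hφ
    have : Nontrivial U := Module.nontrivial_of_finrank_pos (R := ℂ) (by omega)
    obtain ⟨v, hv, χ', hχ'⟩ := exists_common_eigenvector (d + 1) U hd φ hφ
    obtain ⟨χ₀, hχ₀⟩ := LinearMap.exists_eq_smul_of_forall (φ.flip v) hv fun a => ⟨χ' a, hχ' a⟩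
    simp only [LinearMap.flip_apply] at hχ₀
    have hinv : ∀ a, ℂ ∙ v ≤ (ℂ ∙ v).comap (φ a) := fun a => by
      rw [Submodule.span_singleton_le_iff_mem, Submodule.mem_comap, hχ₀]
      exact Submodule.smul_mem _ _ (Submodule.mem_span_singleton_self v)
    let ψ : H →ₗ[ℂ] End ℂ (U ⧸ ℂ ∙ v) :=
      { toFun := fun a => (ℂ ∙ v).mapQ _ (φ a) (hinv a)
        map_add' := fun a b => by ext x; simp
        map_smul' := fun c a => by ext x; simp }
    have hψ : ∀ a x, ψ a (Submodule.Quotient.mk x) = Submodule.Quotient.mk (φ a x) :=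
      fun a x => rfl
    have hfin : finrank ℂ (U ⧸ ℂ ∙ v) = d := by
      have := Submodule.finrank_quotient_add_finrank (ℂ ∙ v)
      rw [finrank_span_singleton hv] at this
      omega
    obtain ⟨χ, hχ⟩ := ih (U ⧸ ℂ ∙ v) hfin ψ (fun a b => by
      ext x
      simpa [hψ] using congrArg Submodule.Quotient.mk (congr($(hφ a b) x)))
    refine ⟨Fin.cons χ₀ χ, fun a μ => ⟨fun h => ?_, ?_⟩⟩
    · obtain ⟨w, hw⟩ := h.exists_hasEigenvector
      have hw' := hw.apply_eq_smul
      by_cases hwv : w ∈ ℂ ∙ v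
      · obtain ⟨c, rfl⟩ := Submodule.mem_span_singleton.1 hwv
        refine ⟨0, ?_⟩
        rw [map_smul, hχ₀, smul_comm] at hw'
        exact smul_left_injective ℂ hw.2 hw'
      · obtain ⟨i, hi⟩ := (hχ a μ).1 (Module.End.hasEigenvalue_of_hasEigenvector
          (x := Submodule.Quotient.mk w) ⟨Module.End.mem_eigenspace_iff.2 (by
            rw [hψ, hw', Submodule.Quotient.mk_smul]),
            by rwa [ne_eq, Submodule.Quotient.mk_eq_zero]⟩)
        exact ⟨i.succ, by simpa using hi⟩
    · rintro ⟨i, rfl⟩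
      induction i using Fin.cases with
      | zero =>
        exact Module.End.hasEigenvalue_of_hasEigenvector
          ⟨Module.End.mem_eigenspace_iff.2 (hχ₀ a), hv⟩
      | succ i =>
        rw [Fin.cons_succ]
        have h1 := (hχ a _).2 ⟨i, rfl⟩
        -- An eigenvalue of the quotient lifts: otherwise `φ a` minus that scalar is bijective, so
        -- the induced map on the quotient is onto and hence injective.
        by_contra hcon
        rw [Module.End.hasEigenvalue_iff, not_not, Module.End.eigenspace_def] at hcon
        have hsurj := LinearMap.injective_iff_surjective.1 (LinearMap.ker_eq_bot.1 hcon)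
        refine h1 (?_ : (ψ a).eigenspace (χ i a) = ⊥)
        rw [Module.End.eigenspace_def, LinearMap.ker_eq_bot, LinearMap.injective_iff_surjective]
        intro x
        obtain ⟨x, rfl⟩ := Submodule.Quotient.mk_surjective _ x
        obtain ⟨y, rfl⟩ := hsurj x
        exact ⟨Submodule.Quotient.mk y, by simp [hψ]⟩

/-- Minus its `b s` component, `v` lies both in the generalized eigenspace of `μ s` and in the sum
of the others, which are independent. -/
theorem mem_span_singleton_of_mem_maxGenEigenspace {ι : Type*} (E : End ℂ U) (b : Basis ι ℂ U)
    (μ : ι → ℂ) (hμ : Function.Injective μ) (hb : ∀ s, b s ∈ E.maxGenEigenspace (μ s))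
    {s : ι} {v : U} (hv : v ∈ E.maxGenEigenspace (μ s)) : v ∈ ℂ ∙ b s := by
  have hind := E.independent_maxGenEigenspace.comp hμ
  have h1 : v - b.repr v s • b s ∈ E.maxGenEigenspace (μ s) :=
    Submodule.sub_mem _ hv (Submodule.smul_mem _ _ (hb s))
  have h2 : v - b.repr v s • b s ∈ ⨆ (s' : ι) (_ : s' ≠ s), E.maxGenEigenspace (μ s') := by
    classical
    have : v - b.repr v s • b s = ∑ s' ∈ (b.repr v).support.erase s, b.repr v s' • b s' := by
      rw [sub_eq_iff_eq_add]
      conv_lhs => rw [← b.linearCombination_repr v, Finsupp.linearCombination_apply, Finsupp.sum]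
      by_cases hs : s ∈ (b.repr v).support
      · rw [Finset.sum_erase_add _ _ hs]
      · rw [Finset.erase_eq_of_notMem hs, Finsupp.notMem_support_iff.1 hs, zero_smul, add_zero]
    rw [this]
    refine Submodule.sum_mem _ fun s' hs' => Submodule.smul_mem _ _ ?_
    exact Submodule.mem_iSup_of_mem s'
      (Submodule.mem_iSup_of_mem (Finset.ne_of_mem_erase hs') (hb s'))
  have h3 := Submodule.disjoint_def.1 (hind s) _ h1 h2
  rw [Submodule.mem_span_singleton]
  exact ⟨_, (sub_eq_zero.1 h3).symm⟩

/-- Pulled back along the independent family, `E` becomes the diagonal operator `g` on coefficients.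
-/
theorem coeff_eq_zero_of_eigenvector {ι : Type*} (E : End ℂ U) {b : ι → U}
    (hind : LinearIndependent ℂ b) (μ : ι → ℂ) (hb : ∀ s, E (b s) = μ s • b s) {ν : ℂ}
    {c : ι →₀ ℂ} (hc : E (Finsupp.linearCombination ℂ b c) = ν • Finsupp.linearCombination ℂ b c)
    {s : ι} (hs : μ s ≠ ν) : c s = 0 := by
  let g : (ι →₀ ℂ) →ₗ[ℂ] (ι →₀ ℂ) := Finsupp.linearCombination ℂ fun s => Finsupp.single s (μ s)
  have hg : E ∘ₗ Finsupp.linearCombination ℂ b = Finsupp.linearCombination ℂ b ∘ₗ g := by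
    ext s
    simp [g, hb]
  have hgs : Finsupp.lapply s ∘ₗ g = μ s • Finsupp.lapply s := by
    ext s'
    by_cases h : s' = s
    · subst h; simp [g]
    · simp [g, h]
  have h1 : g c = ν • c := by
    refine hind ?_
    rw [map_smul, ← hc]
    exact congr($hg.symm c)
  have h2 : μ s * c s = ν * c s := by
    have h3 : (g c) s = μ s * c s := congr($hgs c)
    rw [← h3, h1]
    rfl
  exact (mul_eq_mul_right_iff.1 h2).resolve_left hs

theorem eq_zero_of_eigenvector {ι : Type*} (E : End ℂ U) {b : ι → U}
    (hind : LinearIndependent ℂ b) (μ : ι → ℂ) (hb : ∀ s, E (b s) = μ s • b s) {ν : ℂ}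
    (hν : ∀ s, μ s ≠ ν) {v : U} (hvb : v ∈ Submodule.span ℂ (Set.range b)) (hv : E v = ν • v) :
    v = 0 := by
  obtain ⟨c, rfl⟩ := Finsupp.mem_span_range_iff_exists_finsupp.1 hvb
  rw [← Finsupp.linearCombination_apply] at *
  have : c = 0 := Finsupp.ext fun s => coeff_eq_zero_of_eigenvector E hind μ hb hv (hν s)
  rw [this, map_zero]

theorem exists_eq_smul_of_eigenvector {ι : Type*} (E : End ℂ U) {b : ι → U}
    (hind : LinearIndependent ℂ b) (μ : ι → ℂ) (hμ : Function.Injective μ)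
    (hb : ∀ s, E (b s) = μ s • b s) {s : ι} {v : U}
    (hvb : v ∈ Submodule.span ℂ (Set.range b)) (hv : E v = μ s • v) :
    ∃ c : ℂ, v = c • b s := by
  obtain ⟨c, rfl⟩ := Finsupp.mem_span_range_iff_exists_finsupp.1 hvb
  rw [← Finsupp.linearCombination_apply] at *
  have : c = Finsupp.single s (c s) := Finsupp.ext fun s' => by
    by_cases h : s' = s
    · subst h; simp
    · rw [Finsupp.single_eq_of_ne h]
      exact coeff_eq_zero_of_eigenvector E hind μ hb hv (hμ.ne h)
  refine ⟨c s, ?_⟩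
  conv_lhs => rw [this]
  simp

end LinearAlgebra

/-! ### Jordan chains of R and an operator D with DR = RD + R -/

section Chains

variable {A : Type*} [AddCommGroup A] [Module ℂ A]

/-- `R` shifts each block of the basis `b` by one step and kills its last vector. -/
def IsChainBasis (R : End ℂ A) {q : ℕ} {l : Fin q → ℕ} (b : Basis (Σ j, Fin (l j)) ℂ A) : Prop :=
  ∀ j (i : Fin (l j)), R (b ⟨j, i⟩) = if h : i.val + 1 < l j then b ⟨j, ⟨i.val + 1, h⟩⟩ else 0

theorem IsChainBasis.pow_apply {R : End ℂ A} {q : ℕ} {l : Fin q → ℕ}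
    {b : Basis (Σ j, Fin (l j)) ℂ A} (hb : IsChainBasis R b) (r : ℕ) (j : Fin q) (i : Fin (l j)) :
    (R ^ r) (b ⟨j, i⟩) = if h : i.val + r < l j then b ⟨j, ⟨i.val + r, h⟩⟩ else 0 := by
  induction r with
  | zero => simp
  | succ r ih =>
    rw [pow_succ', Module.End.mul_apply, ih]
    by_cases h : i.val + r < l j
    · rw [dif_pos h, hb]
      rfl
    · rw [dif_neg h, dif_neg (by omega), map_zero]

/-- The basis vectors at position at least `r` span the image. These ranks recover the block
lengths. -/
theorem IsChainBasis.finrank_range_pow {R : End ℂ A} {q : ℕ} {l : Fin q → ℕ}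
    {b : Basis (Σ j, Fin (l j)) ℂ A} (hb : IsChainBasis R b) (r : ℕ) :
    finrank ℂ (LinearMap.range (R ^ r)) = ∑ j, (l j - r) := by
  let g : (Σ j, Fin (l j - r)) → A := fun s => b ⟨s.1, ⟨s.2.val + r, by omega⟩⟩
  have hg : LinearIndependent ℂ g := b.linearIndependent.comp _ fun s s' h => by
    obtain ⟨j, i⟩ := s
    obtain ⟨j', i'⟩ := s'
    simp only [Sigma.mk.injEq] at h
    obtain ⟨rfl, h⟩ := h
    simp only [heq_eq_eq, Fin.mk.injEq, Nat.add_right_cancel_iff] at h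
    rw [Fin.ext h]
  have hrange : LinearMap.range (R ^ r) = Submodule.span ℂ (Set.range g) := by
    rw [LinearMap.range_eq_map, ← b.span_eq, Submodule.map_span]
    refine le_antisymm (Submodule.span_le.2 ?_) (Submodule.span_le.2 ?_)
    · rintro _ ⟨_, ⟨⟨j, i⟩, rfl⟩, rfl⟩
      rw [hb.pow_apply]
      split_ifs with h
      · exact Submodule.subset_span ⟨⟨j, ⟨i, by omega⟩⟩, rfl⟩
      · exact Submodule.zero_mem _
    · rintro _ ⟨⟨j, i⟩, rfl⟩
      refine Submodule.subset_span ⟨_, ⟨⟨j, ⟨i.val, by omega⟩⟩, rfl⟩, ?_⟩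
      rw [hb.pow_apply, dif_pos (by simp only; omega)]
  rw [hrange, finrank_span_eq_card hg]
  simp

/-- With truncated subtraction, first differences in `r` count the entries exceeding `r`, and second
differences count the entries of each value; equal counts give a bijection of fibers. -/
theorem exists_perm_of_sum_tsub_eq {q : ℕ} (l n : Fin q → ℕ)
    (h : ∀ r, ∑ j, (l j - r) = ∑ j, (n j - r)) : ∃ σ : Equiv.Perm (Fin q), ∀ j, l (σ j) = n j := by
  have hstep : ∀ (f : Fin q → ℕ) (r : ℕ), ∑ j, (f j - r) =
      ∑ j, (f j - (r + 1)) + (Finset.univ.filter fun j => r < f j).card := by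
    intro f r
    rw [Finset.card_filter, ← Finset.sum_add_distrib]
    refine Finset.sum_congr rfl fun j _ => ?_
    split_ifs <;> omega
  have hlt : ∀ r, (Finset.univ.filter fun j => r < l j).card =
      (Finset.univ.filter fun j => r < n j).card := by
    intro r
    have h1 := hstep l r
    have h2 := hstep n r
    rw [h r, h (r + 1)] at h1
    omega
  have hle : ∀ r, (Finset.univ.filter fun j => r ≤ l j).card =
      (Finset.univ.filter fun j => r ≤ n j).card := by
    intro r
    cases r with
    | zero => simp
    | succ r => exact hlt r
  have hsplit : ∀ (f : Fin q → ℕ) (r : ℕ), (Finset.univ.filter fun j => r ≤ f j).card =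
      (Finset.univ.filter fun j => f j = r).card + (Finset.univ.filter fun j => r < f j).card := by
    intro f r
    simp only [Finset.card_filter]
    rw [← Finset.sum_add_distrib]
    refine Finset.sum_congr rfl fun j _ => ?_
    split_ifs <;> omega
  have heq : ∀ r, Fintype.card {j // n j = r} = Fintype.card {j // l j = r} := by
    intro r
    rw [Fintype.card_subtype, Fintype.card_subtype]
    have h1 := hsplit l r
    have h2 := hsplit n r
    rw [hle r, hlt r] at h1
    omega
  exact ⟨Equiv.ofFiberEquiv fun r => Fintype.equivOfCardEq (heq r),
    fun j => Equiv.ofFiberEquiv_map _ j⟩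

/-- The relation reads (D − μ − 1)R = R(D − μ), so powers pass through R. -/
theorem mem_maxGenEigenspace_shift {R D : End ℂ A} (hDR : ∀ v, D (R v) = R (D v) + R v) {μ : ℂ}
    {v : A} (hv : v ∈ D.maxGenEigenspace μ) : R v ∈ D.maxGenEigenspace (μ + 1) := by
  rw [Module.End.mem_maxGenEigenspace] at hv ⊢
  obtain ⟨k, hk⟩ := hv
  refine ⟨k, ?_⟩
  have : ∀ (r : ℕ) (w : A), ((D - (μ + 1) • (1 : End ℂ A)) ^ r) (R w) =
      R (((D - μ • (1 : End ℂ A)) ^ r) w) := by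
    intro r
    induction r with
    | zero => simp
    | succ r ih =>
      intro w
      rw [pow_succ, Module.End.mul_apply, pow_succ, Module.End.mul_apply, ← ih]
      congr 1
      simp only [LinearMap.sub_apply, LinearMap.add_apply, LinearMap.smul_apply, Module.End.one_apply,
        hDR, map_sub, map_smul, add_smul, one_smul]
      abel
  rw [this, hk, map_zero]

theorem map_mem_maxGenEigenspace {B : Type*} [AddCommGroup B] [Module ℂ B] (f : A →ₗ[ℂ] B)
    {D : End ℂ A} {Q : End ℂ B} (hf : ∀ v, f (D v) = Q (f v)) {μ : ℂ} {v : A}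
    (hv : v ∈ D.maxGenEigenspace μ) : f v ∈ Q.maxGenEigenspace μ := by
  rw [Module.End.mem_maxGenEigenspace] at hv ⊢
  obtain ⟨k, hk⟩ := hv
  refine ⟨k, ?_⟩
  have : ∀ (r : ℕ) (w : A), ((Q - μ • (1 : End ℂ B)) ^ r) (f w) =
      f (((D - μ • (1 : End ℂ A)) ^ r) w) := by
    intro r
    induction r with
    | zero => simp
    | succ r ih =>
      intro w
      rw [pow_succ, Module.End.mul_apply, pow_succ, Module.End.mul_apply, ← ih]
      simp only [LinearMap.sub_apply, LinearMap.smul_apply, Module.End.one_apply, hf, map_sub,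
        map_smul]
  rw [this, hk, map_zero]

/-- If `W` contained the whole generalized eigenspace for `c`, the quotient would be the sum of its
generalized eigenspaces for the other scalars, leaving no room for `c`. -/
theorem exists_mem_maxGenEigenspace_notMem [FiniteDimensional ℂ A] (D : End ℂ A)
    (W : Submodule ℂ A) (Q : End ℂ (A ⧸ W)) (hQ : ∀ v, Q (W.mkQ v) = W.mkQ (D v)) {c : ℂ}
    (hc : Q.HasEigenvalue c) :
    ∃ v ∈ D.maxGenEigenspace c, v ∉ W := by
  by_contra! hcon
  have hmap : ∀ μ, (D.maxGenEigenspace μ).map W.mkQ ≤ Q.maxGenEigenspace μ :=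
    fun μ => Submodule.map_le_iff_le_comap.2 fun v hv =>
      map_mem_maxGenEigenspace W.mkQ (fun v => (hQ v).symm) hv
  have htop : ⨆ (μ : ℂ) (_ : μ ≠ c), Q.maxGenEigenspace μ = ⊤ := by
    rw [eq_top_iff, ← W.range_mkQ, LinearMap.range_eq_map,
      ← Module.End.iSup_maxGenEigenspace_eq_top D, Submodule.map_iSup]
    refine iSup_le fun μ => ?_
    by_cases hμ : μ = c
    · rintro _ ⟨v, hv, rfl⟩
      rw [Submodule.mkQ_apply, (Submodule.Quotient.mk_eq_zero W).2 (hcon v (hμ ▸ hv))]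
      exact Submodule.zero_mem _
    · exact (hmap μ).trans (le_iSup₂_of_le μ hμ le_rfl)
  have hdis := Q.independent_maxGenEigenspace c
  rw [htop, disjoint_top] at hdis
  obtain ⟨v, hv⟩ := hc.exists_hasEigenvector
  exact hv.2 (by simpa [hdis] using Module.End.eigenspace_le_maxGenEigenspace hv.1)

theorem IsChainBasis.pow_sum_eq_zero {R : End ℂ A} {q : ℕ} {l : Fin q → ℕ}
    {b : Basis (Σ j, Fin (l j)) ℂ A} (hb : IsChainBasis R b) : R ^ (∑ j, l j) = 0 := by
  refine b.ext fun ⟨j, i⟩ => ?_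
  rw [hb.pow_apply, dif_neg, LinearMap.zero_apply]
  have := Finset.single_le_sum (f := l) (fun _ _ => Nat.zero_le _) (Finset.mem_univ j)
  omega

/-- Each nonempty block loses exactly its first vector in the passage to the image. -/
theorem IsChainBasis.finrank_quotient [FiniteDimensional ℂ A] {R : End ℂ A} {q : ℕ}
    {l : Fin q → ℕ} (hl : ∀ j, 1 ≤ l j) {b : Basis (Σ j, Fin (l j)) ℂ A} (hb : IsChainBasis R b) :
    finrank ℂ (A ⧸ LinearMap.range R) = q := by
  have h1 := Submodule.finrank_quotient_add_finrank (LinearMap.range R)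
  have h2 := hb.finrank_range_pow 1
  have h3 := hb.finrank_range_pow 0
  rw [pow_one] at h2
  rw [pow_zero, Module.End.one_eq_id, LinearMap.range_id, finrank_top] at h3
  have h4 : ∑ j, (l j - 0) = ∑ j, (l j - 1) + q := by
    have : ∑ j, (l j - 0) = ∑ j, ((l j - 1) + 1) :=
      Finset.sum_congr rfl fun j _ => by have := hl j; omega
    rw [this, Finset.sum_add_distrib]
    simp
  omega

/-- Nakayama's argument for a nilpotent operator: the span S of the orbits is R-stable and S + im R
is everything, so S + im Rʳ is everything for all r. -/
theorem span_pow_apply_eq_top {R : End ℂ A} {N q : ℕ} (hnil : R ^ N = 0) {x : Fin q → A}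
    (hspan : Submodule.span ℂ (Set.range fun j => (LinearMap.range R).mkQ (x j)) = ⊤) :
    Submodule.span ℂ (Set.range fun s : Fin q × ℕ => (R ^ s.2) (x s.1)) = ⊤ := by
  set S : Submodule ℂ A := Submodule.span ℂ (Set.range fun s : Fin q × ℕ => (R ^ s.2) (x s.1))
  have hSR : S.map R ≤ S := by
    rw [Submodule.map_span, Submodule.span_le]
    rintro _ ⟨_, ⟨⟨j, i⟩, rfl⟩, rfl⟩
    refine Submodule.subset_span ⟨⟨j, i + 1⟩, ?_⟩
    simp only [pow_succ', Module.End.mul_apply]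
  have hSW : S ⊔ (LinearMap.range R) = ⊤ := by
    have h1 : (⊤ : Submodule ℂ (A ⧸ (LinearMap.range R))) ≤ S.map (LinearMap.range R).mkQ := by
      rw [← hspan, Submodule.span_le]
      rintro _ ⟨j, rfl⟩
      exact ⟨x j, Submodule.subset_span ⟨⟨j, 0⟩, by simp⟩, rfl⟩
    have h2 := Submodule.comap_mono (f := (LinearMap.range R).mkQ) h1
    rw [Submodule.comap_top, Submodule.comap_map_mkQ, sup_comm] at h2
    exact top_le_iff.1 h2
  have hSpow : ∀ r, S ⊔ LinearMap.range (R ^ r) = ⊤ := by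
    intro r
    induction r with
    | zero => simp [Module.End.one_eq_id]
    | succ r ih =>
      rw [eq_top_iff, ← hSW, LinearMap.range_eq_map R, ← ih, Submodule.map_sup]
      refine sup_le le_sup_left (sup_le (hSR.trans le_sup_left) (le_sup_of_le_right ?_))
      rintro _ ⟨_, ⟨v, rfl⟩, rfl⟩
      exact ⟨v, by rw [pow_succ', Module.End.mul_apply]⟩
  have := hSpow N
  rwa [hnil, LinearMap.range_zero, sup_bot_eq] at this

/-- The vectors Rⁱxⱼ lie in generalized eigenspaces for the distinct scalars cⱼ + i, so the nonzero
ones form a basis. Each such eigenspace is then a line, which makes the generalized eigenvectors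
true ones. -/
theorem exists_chain_eigenbasis_of_span [FiniteDimensional ℂ A] {R D : End ℂ A}
    (hDR : ∀ v, D (R v) = R (D v) + R v) {N q : ℕ} (hnil : R ^ N = 0) {x : Fin q → A}
    (hS : Submodule.span ℂ (Set.range fun s : Fin q × ℕ => (R ^ s.2) (x s.1)) = ⊤)
    (c : Fin q → ℂ) (hx : ∀ j, x j ∈ D.maxGenEigenspace (c j))
    (hcinj : ∀ j j' (i i' : ℕ), c j + i = c j' + i' → j = j') :
    ∃ (l : Fin q → ℕ) (Y : Basis (Σ j, Fin (l j)) ℂ A), IsChainBasis R Y ∧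
      ∀ j (i : Fin (l j)), D (Y ⟨j, i⟩) = (c j + i.val) • Y ⟨j, i⟩ := by
  have hex : ∀ j, ∃ r, (R ^ r) (x j) = 0 := fun j => ⟨N, by rw [hnil]; rfl⟩
  classical
  let l : Fin q → ℕ := fun j => Nat.find (hex j)
  have hl : ∀ j r, l j ≤ r → (R ^ r) (x j) = 0 := by
    intro j r hr
    obtain ⟨s, rfl⟩ := Nat.exists_eq_add_of_le' hr
    rw [pow_add, Module.End.mul_apply, Nat.find_spec (hex j), map_zero]
  have hgen : ∀ j (i : ℕ), (R ^ i) (x j) ∈ D.maxGenEigenspace (c j + i) := by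
    intro j i
    induction i with
    | zero => simpa using hx j
    | succ i ih =>
      rw [pow_succ', Module.End.mul_apply, Nat.cast_succ, ← add_assoc]
      exact mem_maxGenEigenspace_shift hDR ih
  let μ : (Σ j, Fin (l j)) → ℂ := fun s => c s.1 + (s.2.val : ℕ)
  have hμ : Function.Injective μ := by
    rintro ⟨j, i⟩ ⟨j', i'⟩ h
    obtain rfl := hcinj _ _ _ _ h
    have : i.val = i'.val := by
      have := add_left_cancel h
      exact_mod_cast this
    rw [Fin.ext this]
  let g : (Σ j, Fin (l j)) → A := fun s => (R ^ s.2.val) (x s.1)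
  have hgμ : ∀ s, g s ∈ D.maxGenEigenspace (μ s) := fun s => hgen _ _
  have hgind : LinearIndependent ℂ g := by
    refine (D.independent_maxGenEigenspace.comp hμ).linearIndependent _ hgμ fun s => ?_
    exact Nat.find_min (hex s.1) s.2.isLt
  have hgspan : ⊤ ≤ Submodule.span ℂ (Set.range g) := by
    rw [← hS, Submodule.span_le]
    rintro _ ⟨⟨j, i⟩, rfl⟩
    by_cases hi : i < l j
    · exact Submodule.subset_span ⟨⟨j, ⟨i, hi⟩⟩, rfl⟩
    · simp only [hl j i (not_lt.1 hi)]
      exact Submodule.zero_mem _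
  let Y : Basis (Σ j, Fin (l j)) ℂ A := Basis.mk hgind hgspan
  have hY : ∀ j (i : Fin (l j)), Y ⟨j, i⟩ = (R ^ i.val) (x j) := fun j i => Basis.mk_apply _ _ _
  have hYchain : IsChainBasis R Y := by
    intro j i
    rw [hY, ← Module.End.mul_apply, ← pow_succ']
    split_ifs with h
    · rw [hY]
    · exact hl _ _ (not_lt.1 h)
  have hYD : ∀ s, D (Y s) = μ s • Y s := by
    intro s
    have hYs : Y s ∈ D.maxGenEigenspace (μ s) := by
      rw [show Y s = g s from Basis.mk_apply _ _ _]
      exact hgμ s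
    have h1 := mem_span_singleton_of_mem_maxGenEigenspace D Y μ hμ
      (fun s => by rw [show Y s = g s from Basis.mk_apply _ _ _]; exact hgμ s)
      (Module.End.mapsTo_maxGenEigenspace_of_comm (Commute.refl D) _ hYs)
    obtain ⟨a, ha⟩ := Submodule.mem_span_singleton.1 h1
    -- `D` preserves the line of `Y s`, so `Y s` has some eigenvalue `a`. Were it different from `μ
    -- s`, the vector would lie in two independent generalized eigenspaces.
    by_cases haμ : a = μ s
    · rw [← ha, haμ]
    · have h2 : Y s ∈ D.maxGenEigenspace a :=
        Module.End.eigenspace_le_maxGenEigenspace (Module.End.mem_eigenspace_iff.2 ha.symm)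
      have h3 := Submodule.disjoint_def.1 (D.disjoint_genEigenspace haμ ⊤ ⊤) _ h2 hYs
      exact absurd h3 (Y.ne_zero s)
  exact ⟨l, Y, hYchain, fun j i => hYD ⟨j, i⟩⟩

/-- The permutation records which prescribed eigenvalue lands on which block; the hypotheses do not
determine it. -/
theorem exists_chain_eigenbasis [FiniteDimensional ℂ A] {R D : End ℂ A}
    (hDR : ∀ v, D (R v) = R (D v) + R v) {q : ℕ} {n : Fin q → ℕ} (hn : ∀ j, 1 ≤ n j)
    {b : Basis (Σ j, Fin (n j)) ℂ A} (hb : IsChainBasis R b)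
    (Q : End ℂ (A ⧸ LinearMap.range R))
    (hQ : ∀ v, Q ((LinearMap.range R).mkQ v) = (LinearMap.range R).mkQ (D v))
    (c : Fin q → ℂ) (hc : ∀ j, Q.HasEigenvalue (c j))
    (hcinj : ∀ j j' (i i' : ℕ), c j + i = c j' + i' → j = j') :
    ∃ (σ : Equiv.Perm (Fin q)) (X : Basis (Σ j, Fin (n j)) ℂ A), IsChainBasis R X ∧
      ∀ j (i : Fin (n j)), D (X ⟨j, i⟩) = (c (σ j) + i.val) • X ⟨j, i⟩ := by
  choose x hx hxR using fun j => exists_mem_maxGenEigenspace_notMem D _ Q hQ (hc j)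
  have hcinj' : Function.Injective c := fun j j' h => hcinj j j' 0 0 (by rw [h])
  have hnil := hb.pow_sum_eq_zero
  have hfin := hb.finrank_quotient hn
  have hmap : ∀ μ v, v ∈ D.maxGenEigenspace μ → (LinearMap.range R).mkQ v ∈ Q.maxGenEigenspace μ :=
    fun μ v hv => map_mem_maxGenEigenspace (LinearMap.range R).mkQ (fun v => (hQ v).symm) hv
  have hspan : Submodule.span ℂ (Set.range fun j => (LinearMap.range R).mkQ (x j)) = ⊤ := by
    -- There are as many classes as the dimension of the quotient, and they are nonzero vectors of
    -- distinct generalized eigenspaces.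
    refine LinearIndependent.span_eq_top_of_card_eq_finrank' (K := ℂ) ?_ (by simp [hfin])
    refine (Q.independent_maxGenEigenspace.comp hcinj').linearIndependent _
      (fun j => hmap _ _ (hx j)) fun j => ?_
    rw [Submodule.mkQ_apply, ne_eq, Submodule.Quotient.mk_eq_zero]
    exact hxR j
  have hS := span_pow_apply_eq_top hnil hspan
  obtain ⟨l, Y, hYchain, hYD⟩ := exists_chain_eigenbasis_of_span hDR hnil hS c hx hcinj
  -- Both chain bases compute the ranks of all powers of `R`, so the lengths agree up to order.
  obtain ⟨σ, hσ⟩ := exists_perm_of_sum_tsub_eq l n fun r => by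
    rw [← hb.finrank_range_pow, ← hYchain.finrank_range_pow]
  let e : (Σ j, Fin (n j)) ≃ (Σ j, Fin (l j)) := Equiv.sigmaCongr σ fun j => finCongr (hσ j).symm
  have he : ∀ j (i : Fin (n j)), e ⟨j, i⟩ = ⟨σ j, ⟨i.val, by rw [hσ]; exact i.isLt⟩⟩ :=
    fun j i => rfl
  refine ⟨σ, Y.reindex e.symm, fun j i => ?_, fun j i => ?_⟩
  · simp only [Basis.reindex_apply, Equiv.symm_symm, he]
    rw [hYchain]
    simp only [hσ]
  · simp only [Basis.reindex_apply, Equiv.symm_symm, he]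
    exact hYD _ _

end Chains

/-! ### Products inside the nilradical and the action of L on its blocks -/

namespace ComplexSuperalgebra

variable {V : Type u} [AddCommGroup V] [Module ℂ V]

theorem isCompl_part (L : ComplexSuperalgebra V) : IsCompl (L.part 0) (L.part 1) := by
  refine (DirectSum.isInternal_submodule_iff_isCompl L.part (by decide) ?_).1 L.isInternal
  have : ∀ i : ZMod 2, i = 0 ∨ i = 1 := by decide
  ext i
  simpa using this i

theorem exists_parts (L : ComplexSuperalgebra V) (v : V) :
    ∃ v₀ ∈ L.part 0, ∃ v₁ ∈ L.part 1, v = v₀ + v₁ := by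
  have : v ∈ L.part 0 ⊔ L.part 1 := L.isCompl_part.sup_eq_top ▸ Submodule.mem_top
  obtain ⟨a, ha, b, hb, h⟩ := Submodule.mem_sup.1 this
  exact ⟨a, ha, b, hb, h.symm⟩

theorem eq_zero_of_mem_part (L : ComplexSuperalgebra V) {v : V} (h₀ : v ∈ L.part 0)
    (h₁ : v ∈ L.part 1) : v = 0 :=
  Submodule.disjoint_def.1 L.isCompl_part.disjoint v h₀ h₁

/-- Right multiplication by `a`. -/
def rmul (L : ComplexSuperalgebra V) (a : V) : End ℂ V := L.bracket.flip a

@[simp]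
theorem rmul_apply (L : ComplexSuperalgebra V) (a v : V) : L.rmul a v = L.bracket v a := rfl

theorem bracket_mem_even_right (L : ComplexSuperalgebra V) {i : ZMod 2} {x y : V}
    (hx : x ∈ L.part i) (hy : y ∈ L.part 0) : L.bracket x y ∈ L.part i := by
  simpa using L.bracket_mem i 0 x hx y hy

theorem IsLeibniz.bracket_bracket_even_right {L : ComplexSuperalgebra V} (hL : L.IsLeibniz)
    {i : ZMod 2} (x : V) {y z : V} (hy : y ∈ L.part i) (hz : z ∈ L.part 0) :
    L.bracket x (L.bracket y z) =
      L.bracket (L.bracket x y) z - L.bracket (L.bracket x z) y := by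
  simpa using hL i 0 x y hy z hz

theorem IsLeibniz.bracket_bracket_even_left {L : ComplexSuperalgebra V} (hL : L.IsLeibniz)
    {i : ZMod 2} (x : V) {y z : V} (hy : y ∈ L.part 0) (hz : z ∈ L.part i) :
    L.bracket x (L.bracket y z) =
      L.bracket (L.bracket x y) z - L.bracket (L.bracket x z) y := by
  simpa using hL 0 i x y hy z hz

theorem bracket_mem_square (L : ComplexSuperalgebra V) (x y : V) : L.bracket x y ∈ L.square :=
  Submodule.apply_mem_map₂ _ Submodule.mem_top Submodule.mem_top

/-- Needed so that a nilpotent square is contained in the nilradical. -/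
theorem isIdeal_square (L : ComplexSuperalgebra V) : L.IsIdeal L.square := by
  refine ⟨le_antisymm ?_ (sup_le inf_le_left inf_le_left), fun x _ y => L.bracket_mem_square x y,
    fun x _ y => L.bracket_mem_square y x⟩
  refine Submodule.map₂_le.2 fun x _ y _ => ?_
  obtain ⟨x₀, hx₀, x₁, hx₁, rfl⟩ := L.exists_parts x
  obtain ⟨y₀, hy₀, y₁, hy₁, rfl⟩ := L.exists_parts y
  have h : ∀ i j : ZMod 2, ∀ x ∈ L.part i, ∀ y ∈ L.part j,
      L.bracket x y ∈ L.square ⊓ L.part 0 ⊔ L.square ⊓ L.part 1 := by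
    intro i j x hx y hy
    have hm := L.bracket_mem i j x hx y hy
    have hij : i + j = 0 ∨ i + j = 1 := by
      generalize i + j = t
      revert t
      decide
    rcases hij with h | h <;> rw [h] at hm
    · exact Submodule.mem_sup_left ⟨L.bracket_mem_square x y, hm⟩
    · exact Submodule.mem_sup_right ⟨L.bracket_mem_square x y, hm⟩
  simp only [map_add, LinearMap.add_apply]
  exact add_mem (add_mem (h 0 0 _ hx₀ _ hy₀) (h 1 0 _ hx₁ _ hy₀))
    (add_mem (h 0 1 _ hx₀ _ hy₁) (h 1 1 _ hx₁ _ hy₁))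

/-- A Leibniz superalgebra `L` with nilradical `N` containing `[L, L]`. -/
structure IsNilradicalExtension (L : ComplexSuperalgebra V) (N : Submodule ℂ V) : Prop where
  leibniz : L.IsLeibniz
  nilradical : L.IsNilradical N
  bracket_mem_nilradical : ∀ x y, L.bracket x y ∈ N

/-- A family `e` of vectors spanning `N` with the products of the standard basis of `NP n m`,
together with a functional `κ` that reads off the coefficient of `x₁` on `N`. -/
structure IsNPFrame {k p : ℕ} {n : Fin k → ℕ} {m : Fin p → ℕ} (L : ComplexSuperalgebra V)
    (N : Submodule ℂ V) (e : NPIndex n m → V) (κ : V →ₗ[ℂ] ℂ) : Prop where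
  indep : LinearIndependent ℂ e
  span_eq : Submodule.span ℂ (Set.range e) = N
  mem_part : ∀ a, e a ∈ L.part a.deg
  bracket_x1_right : ∀ a, L.bracket (e a) (e .x1) = Finsupp.linearCombination ℂ e (a.table .x1)
  bracket_x : ∀ a j i, L.bracket (e a) (e (.x j i)) = 0
  bracket_y : ∀ a j i, L.bracket (e a) (e (.y j i)) = 0
  κ_x1 : κ (e .x1) = 1
  κ_x : ∀ j i, κ (e (.x j i)) = 0
  κ_y : ∀ j i, κ (e (.y j i)) = 0

variable {k p : ℕ} {n : Fin k → ℕ} {m : Fin p → ℕ} {L : ComplexSuperalgebra V}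
  {N : Submodule ℂ V} {e : NPIndex n m → V} {κ : V →ₗ[ℂ] ℂ}

theorem IsNPFrame.mem (hf : L.IsNPFrame N e κ) (a : NPIndex n m) : e a ∈ N :=
  hf.span_eq ▸ Submodule.subset_span ⟨a, rfl⟩

theorem IsNPFrame.x1_mem_part (hf : L.IsNPFrame N e κ) : e .x1 ∈ L.part 0 := hf.mem_part .x1

theorem IsNPFrame.x_mem_part (hf : L.IsNPFrame N e κ) (j i) : e (.x j i) ∈ L.part 0 :=
  hf.mem_part (.x j i)

theorem IsNPFrame.y_mem_part (hf : L.IsNPFrame N e κ) (j i) : e (.y j i) ∈ L.part 1 :=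
  hf.mem_part (.y j i)

theorem IsNPFrame.bracket_x1_x1 (hf : L.IsNPFrame N e κ) : L.bracket (e .x1) (e .x1) = 0 := by
  rw [hf.bracket_x1_right, NPIndex.table, map_zero]
  all_goals simp

theorem IsNPFrame.bracket_x_x1 (hf : L.IsNPFrame N e κ) (j) (i : Fin (n j)) :
    L.bracket (e (.x j i)) (e .x1) =
      if h : i.val + 1 < n j then e (.x j ⟨i.val + 1, h⟩) else 0 := by
  rw [hf.bracket_x1_right, NPIndex.table]
  split_ifs <;> simp

theorem IsNPFrame.bracket_y_x1 (hf : L.IsNPFrame N e κ) (j) (i : Fin (m j)) :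
    L.bracket (e (.y j i)) (e .x1) =
      if h : i.val + 1 < m j then e (.y j ⟨i.val + 1, h⟩) else 0 := by
  rw [hf.bracket_x1_right, NPIndex.table]
  split_ifs <;> simp

/-- Among the basis vectors only x₁ acts nontrivially from the right; bilinearity does the rest. All
computations in N thereby reduce to one operator. -/
theorem IsNPFrame.bracket_eq (hf : L.IsNPFrame N e κ) {u v : V} (hu : u ∈ N) (hv : v ∈ N) :
    L.bracket u v = κ v • L.bracket u (e .x1) := by
  rw [← hf.span_eq] at hu hv
  induction hv using Submodule.span_induction with
  | zero => simp
  | add v w _ _ h1 h2 => rw [map_add, h1, h2, map_add, add_smul]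
  | smul c v _ h => rw [map_smul, h, map_smul, smul_eq_mul, mul_smul]
  | mem v hv =>
    obtain ⟨b, rfl⟩ := hv
    induction hu using Submodule.span_induction with
    | zero => simp
    | add v w _ _ h1 h2 =>
      rw [map_add, LinearMap.add_apply, h1, h2, LinearMap.add_apply, smul_add]
    | smul c v _ h => rw [map_smul, LinearMap.smul_apply, h, LinearMap.smul_apply, smul_comm]
    | mem u hu =>
      obtain ⟨a, rfl⟩ := hu
      cases b with
      | x1 => rw [hf.κ_x1, one_smul]
      | x j i => rw [hf.bracket_x, hf.κ_x, zero_smul]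
      | y j i => rw [hf.bracket_y, hf.κ_y, zero_smul]

/-- Some `u ∈ N₀` has `[u, x₁] ≠ 0`. -/
theorem IsNPFrame.exists_bracket_ne_zero (hf : L.IsNPFrame N e κ) (hk : 1 ≤ k)
    (hn : ∀ j, 2 ≤ n j) : ∃ u ∈ N, u ∈ L.part 0 ∧ L.bracket u (e .x1) ≠ 0 := by
  have h := hn ⟨0, hk⟩
  refine ⟨e (.x ⟨0, hk⟩ ⟨0, by omega⟩), hf.mem _, hf.x_mem_part _ _, ?_⟩
  rw [hf.bracket_x_x1, dif_pos (by simp only; omega)]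
  exact hf.indep.ne_zero _

/-- For an even u in N with [u,x₁] ≠ 0, the product [u,v] = κ(v)[u,x₁] is both odd and even. -/
theorem IsNPFrame.κ_eq_zero_of_odd (hf : L.IsNPFrame N e κ) (hk : 1 ≤ k)
    (hn : ∀ j, 2 ≤ n j) {v : V} (hv : v ∈ N) (hv' : v ∈ L.part 1) : κ v = 0 := by
  obtain ⟨u, hu, hu', hne⟩ := hf.exists_bracket_ne_zero hk hn
  have h1 := L.bracket_mem 0 1 u hu' v hv'
  rw [hf.bracket_eq hu hv, zero_add] at h1
  have h2 := (L.part 0).smul_mem (κ v) (L.bracket_mem_even_right hu' hf.x1_mem_part)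
  exact (smul_eq_zero.1 (L.eq_zero_of_mem_part h2 h1)).resolve_right hne

/-- The homogeneous component of parity `ε` of the span of the `x`- and `y`-blocks of `N`. -/
def blockPart (L : ComplexSuperalgebra V) (N : Submodule ℂ V) (κ : V →ₗ[ℂ] ℂ) (ε : ZMod 2) :
    Submodule ℂ V :=
  N ⊓ LinearMap.ker κ ⊓ L.part ε

theorem mem_blockPart {ε : ZMod 2} {v : V} :
    v ∈ L.blockPart N κ ε ↔ v ∈ N ∧ κ v = 0 ∧ v ∈ L.part ε := by
  simp [blockPart, and_assoc]

/-- Elements of N killed by κ annihilate N from the right. Expanding [u,[z,a]] by the Leibniz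
identity then gives κ([z,a])[u,x₁] = 0, and u can be chosen with [u,x₁] ≠ 0. -/
theorem IsNPFrame.bracket_mem_blockPart (hf : L.IsNPFrame N e κ) (hk : 1 ≤ k)
    (hn : ∀ j, 2 ≤ n j) (hL : L.IsNilradicalExtension N) {ε i : ZMod 2} {z a : V}
    (hz : z ∈ L.blockPart N κ ε) (ha : a ∈ L.part i) : L.bracket z a ∈ L.blockPart N κ (ε + i) := by
  rw [mem_blockPart] at hz ⊢
  obtain ⟨hzN, hzκ, hzp⟩ := hz
  refine ⟨hL.bracket_mem_nilradical _ _, ?_, L.bracket_mem _ _ _ hzp _ ha⟩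
  obtain ⟨u, hu, hu', hne⟩ := hf.exists_bracket_ne_zero hk hn
  have h := hL.leibniz ε i u z hzp a ha
  rw [hf.bracket_eq hu hzN, hf.bracket_eq (hL.bracket_mem_nilradical u a) hzN, hzκ, zero_smul,
    zero_smul, map_zero, LinearMap.zero_apply, smul_zero, sub_zero,
    hf.bracket_eq hu (hL.bracket_mem_nilradical z a)] at h
  exact (smul_eq_zero.1 h).resolve_right hne

theorem IsNPFrame.bracket_even_mem_blockPart (hf : L.IsNPFrame N e κ) (hk : 1 ≤ k)
    (hn : ∀ j, 2 ≤ n j) (hL : L.IsNilradicalExtension N) {ε : ZMod 2} {z a : V}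
    (hz : z ∈ L.blockPart N κ ε) (ha : a ∈ L.part 0) : L.bracket z a ∈ L.blockPart N κ ε := by
  simpa using hf.bracket_mem_blockPart hk hn hL hz ha

/-- The Leibniz identity for [u,[x₁,a]], where [x₁,a] acts on N as a multiple of x₁. The scalar is
the weight of `a` on x₁. -/
theorem IsNPFrame.bracket_bracket_x1 (hf : L.IsNPFrame N e κ) (hL : L.IsNilradicalExtension N)
    {i : ZMod 2} {u a : V} (hu : u ∈ N) (ha : a ∈ L.part i) :
    L.bracket (L.bracket u (e .x1)) a =
      κ (L.bracket (e .x1) a) • L.bracket u (e .x1) + L.bracket (L.bracket u a) (e .x1) := by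
  rw [← hf.bracket_eq hu (hL.bracket_mem_nilradical _ _),
    hL.leibniz.bracket_bracket_even_left u hf.x1_mem_part ha, sub_add_cancel]

theorem IsNPFrame.exists_eq_add (hf : L.IsNPFrame N e κ) {v : V} (hv : v ∈ N) :
    ∃ z₀ ∈ Submodule.span ℂ (Set.range fun s : Σ j, Fin (n j) => e (.x s.1 s.2)),
    ∃ z₁ ∈ Submodule.span ℂ (Set.range fun s : Σ j, Fin (m j) => e (.y s.1 s.2)),
      v = κ v • e .x1 + z₀ + z₁ := by
  rw [← hf.span_eq] at hv
  induction hv using Submodule.span_induction with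
  | zero => exact ⟨0, zero_mem _, 0, zero_mem _, by simp⟩
  | add v w _ _ h1 h2 =>
    obtain ⟨a, ha, b, hb, h⟩ := h1
    obtain ⟨a', ha', b', hb', h'⟩ := h2
    refine ⟨a + a', add_mem ha ha', b + b', add_mem hb hb', ?_⟩
    conv_lhs => rw [h, h']
    rw [map_add, add_smul]
    abel
  | smul c v _ h =>
    obtain ⟨a, ha, b, hb, h⟩ := h
    refine ⟨c • a, Submodule.smul_mem _ _ ha, c • b, Submodule.smul_mem _ _ hb, ?_⟩
    conv_lhs => rw [h]
    rw [map_smul, smul_add, smul_add, smul_eq_mul, mul_smul]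
  | mem v hv =>
    obtain ⟨b, rfl⟩ := hv
    cases b with
    | x1 => exact ⟨0, zero_mem _, 0, zero_mem _, by simp [hf.κ_x1]⟩
    | x j i =>
      exact ⟨_, Submodule.subset_span ⟨⟨j, i⟩, rfl⟩, 0, zero_mem _, by simp [hf.κ_x]⟩
    | y j i =>
      exact ⟨0, zero_mem _, _, Submodule.subset_span ⟨⟨j, i⟩, rfl⟩, by simp [hf.κ_y]⟩

theorem IsNPFrame.span_x_le (hf : L.IsNPFrame N e κ) :
    Submodule.span ℂ (Set.range fun s : Σ j, Fin (n j) => e (.x s.1 s.2)) ≤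
      L.blockPart N κ 0 := by
  rw [Submodule.span_le]
  rintro _ ⟨s, rfl⟩
  exact mem_blockPart.2 ⟨hf.mem _, hf.κ_x _ _, hf.x_mem_part _ _⟩

theorem IsNPFrame.span_y_le (hf : L.IsNPFrame N e κ) :
    Submodule.span ℂ (Set.range fun s : Σ j, Fin (m j) => e (.y s.1 s.2)) ≤
      L.blockPart N κ 1 := by
  rw [Submodule.span_le]
  rintro _ ⟨s, rfl⟩
  exact mem_blockPart.2 ⟨hf.mem _, hf.κ_y _ _, hf.y_mem_part _ _⟩

theorem IsNPFrame.exists_eq_add_blockPart (hf : L.IsNPFrame N e κ) {v : V} (hv : v ∈ N) :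
    ∃ z₀ ∈ L.blockPart N κ 0, ∃ z₁ ∈ L.blockPart N κ 1, v = κ v • e .x1 + z₀ + z₁ := by
  obtain ⟨z₀, h₀, z₁, h₁, h⟩ := hf.exists_eq_add hv
  exact ⟨z₀, hf.span_x_le h₀, z₁, hf.span_y_le h₁, h⟩

theorem IsNPFrame.blockPart_zero (hf : L.IsNPFrame N e κ) :
    L.blockPart N κ 0 =
      Submodule.span ℂ (Set.range fun s : Σ j, Fin (n j) => e (.x s.1 s.2)) := by
  refine le_antisymm (fun v hv => ?_) hf.span_x_le
  obtain ⟨hvN, hvκ, hvp⟩ := mem_blockPart.1 hv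
  obtain ⟨z₀, h₀, z₁, h₁, h⟩ := hf.exists_eq_add hvN
  rw [hvκ, zero_smul, zero_add] at h
  have : z₁ = 0 := by
    refine L.eq_zero_of_mem_part ?_ (mem_blockPart.1 (hf.span_y_le h₁)).2.2
    rw [← sub_eq_iff_eq_add'.2 h]
    exact sub_mem hvp (mem_blockPart.1 (hf.span_x_le h₀)).2.2
  rwa [h, this, add_zero]

theorem IsNPFrame.blockPart_one (hf : L.IsNPFrame N e κ) :
    L.blockPart N κ 1 =
      Submodule.span ℂ (Set.range fun s : Σ j, Fin (m j) => e (.y s.1 s.2)) := by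
  refine le_antisymm (fun v hv => ?_) hf.span_y_le
  obtain ⟨hvN, hvκ, hvp⟩ := mem_blockPart.1 hv
  obtain ⟨z₀, h₀, z₁, h₁, h⟩ := hf.exists_eq_add hvN
  rw [hvκ, zero_smul, zero_add] at h
  have : z₀ = 0 := by
    refine L.eq_zero_of_mem_part (mem_blockPart.1 (hf.span_x_le h₀)).2.2 ?_
    rw [← sub_eq_iff_eq_add.2 h]
    exact sub_mem hvp (mem_blockPart.1 (hf.span_y_le h₁)).2.2
  rwa [h, this, zero_add]

/-- The right action of the even part of `L` on `blockPart`. -/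
def blockAction (L : ComplexSuperalgebra V) (N : Submodule ℂ V) (κ : V →ₗ[ℂ] ℂ) (ε : ZMod 2)
    (h : ∀ z ∈ L.blockPart N κ ε, ∀ a ∈ L.part 0, L.bracket z a ∈ L.blockPart N κ ε) :
    L.part 0 →ₗ[ℂ] End ℂ (L.blockPart N κ ε) where
  toFun a := (L.rmul a).restrict fun z hz => h z hz a a.2
  map_add' a b := by ext z; exact map_add (L.bracket z) _ _
  map_smul' c a := by ext z; exact map_smul (L.bracket z) _ _

@[simp]
theorem coe_blockAction_apply {ε : ZMod 2}
    (h : ∀ z ∈ L.blockPart N κ ε, ∀ a ∈ L.part 0, L.bracket z a ∈ L.blockPart N κ ε)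
    (a : L.part 0) (z : L.blockPart N κ ε) :
    (L.blockAction N κ ε h a z : V) = L.bracket z a := rfl

theorem IsNPFrame.exists_chainBasis_zero (hf : L.IsNPFrame N e κ)
    (h : ∀ z ∈ L.blockPart N κ 0, ∀ a ∈ L.part 0, L.bracket z a ∈ L.blockPart N κ 0) :
    ∃ b : Basis (Σ j, Fin (n j)) ℂ (L.blockPart N κ 0),
      IsChainBasis (L.blockAction N κ 0 h ⟨e .x1, hf.x1_mem_part⟩) b := by
  have hind : LinearIndependent ℂ fun s : Σ j, Fin (n j) => e (.x s.1 s.2) :=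
    hf.indep.comp (fun s : Σ j, Fin (n j) => NPIndex.x s.1 s.2) fun s s' h => by
      cases s; cases s'; cases h; rfl
  refine ⟨(Basis.span hind).map (LinearEquiv.ofEq _ _ hf.blockPart_zero.symm), fun j i => ?_⟩
  have hb : ∀ s, (((Basis.span hind).map (LinearEquiv.ofEq _ _ hf.blockPart_zero.symm) s :
      L.blockPart N κ 0) : V) = e (.x s.1 s.2) := fun s => by
    simp [Basis.span_apply]
  ext
  rw [coe_blockAction_apply, hb, hf.bracket_x_x1]
  split_ifs
  · rw [hb]
  · rfl

theorem IsNPFrame.exists_chainBasis_one (hf : L.IsNPFrame N e κ)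
    (h : ∀ z ∈ L.blockPart N κ 1, ∀ a ∈ L.part 0, L.bracket z a ∈ L.blockPart N κ 1) :
    ∃ b : Basis (Σ j, Fin (m j)) ℂ (L.blockPart N κ 1),
      IsChainBasis (L.blockAction N κ 1 h ⟨e .x1, hf.x1_mem_part⟩) b := by
  have hind : LinearIndependent ℂ fun s : Σ j, Fin (m j) => e (.y s.1 s.2) :=
    hf.indep.comp (fun s : Σ j, Fin (m j) => NPIndex.y s.1 s.2) fun s s' h => by
      cases s; cases s'; cases h; rfl
  refine ⟨(Basis.span hind).map (LinearEquiv.ofEq _ _ hf.blockPart_one.symm), fun j i => ?_⟩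
  have hb : ∀ s, (((Basis.span hind).map (LinearEquiv.ofEq _ _ hf.blockPart_one.symm) s :
      L.blockPart N κ 1) : V) = e (.y s.1 s.2) := fun s => by
    simp [Basis.span_apply]
  ext
  rw [coe_blockAction_apply, hb, hf.bracket_y_x1]
  split_ifs
  · rw [hb]
  · rfl

/-! ### Criteria for membership in the nilradical -/

theorem IsNilradicalExtension.rmul_pow_mem (hL : L.IsNilradicalExtension N) (a : V) (r : ℕ) {u : V}
    (hu : u ∈ N) : (L.rmul a ^ r) u ∈ N := by
  cases r with
  | zero => exact hu
  | succ r =>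
    rw [pow_succ', Module.End.mul_apply]
    exact hL.bracket_mem_nilradical _ _

theorem IsNPFrame.exists_rmul_x1_pow_eq_zero (hf : L.IsNPFrame N e κ) :
    ∃ q, ∀ u ∈ N, (L.rmul (e .x1) ^ q) u = 0 := by
  -- Any exponent exceeding all block lengths works; the extra factor also disposes of x₁, whose
  -- square is 0.
  refine ⟨∑ j, n j + ∑ j, m j + 1, fun u hu => ?_⟩
  rw [← hf.span_eq] at hu
  induction hu using Submodule.span_induction with
  | zero => simp
  | add v w _ _ h1 h2 => rw [map_add, h1, h2, add_zero]
  | smul c v _ h => rw [map_smul, h, smul_zero]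
  | mem v hv =>
    obtain ⟨b, rfl⟩ := hv
    cases b with
    | x1 =>
      rw [pow_succ, Module.End.mul_apply, rmul_apply, hf.bracket_x1_x1, map_zero]
    | x j i =>
      have key : ∀ r, (L.rmul (e .x1) ^ r) (e (.x j i)) =
          if h : i.val + r < n j then e (.x j ⟨i.val + r, h⟩) else 0 := by
        intro r
        induction r with
        | zero => simp
        | succ r ih =>
          rw [pow_succ', Module.End.mul_apply, ih]
          by_cases h : i.val + r < n j
          · rw [dif_pos h, rmul_apply, hf.bracket_x_x1]
            rfl
          · rw [dif_neg h, dif_neg (by omega), map_zero]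
      have := Finset.single_le_sum (f := n) (fun _ _ => Nat.zero_le _) (Finset.mem_univ j)
      rw [key, dif_neg (by omega)]
    | y j i =>
      have key : ∀ r, (L.rmul (e .x1) ^ r) (e (.y j i)) =
          if h : i.val + r < m j then e (.y j ⟨i.val + r, h⟩) else 0 := by
        intro r
        induction r with
        | zero => simp
        | succ r ih =>
          rw [pow_succ', Module.End.mul_apply, ih]
          by_cases h : i.val + r < m j
          · rw [dif_pos h, rmul_apply, hf.bracket_y_x1]
            rfl
          · rw [dif_neg h, dif_neg (by omega), map_zero]
      have := Finset.single_le_sum (f := m) (fun _ _ => Nat.zero_le _) (Finset.mem_univ j)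
      rw [key, dif_neg (by omega)]

/-- Every product lies in N, so any subspace containing N absorbs products; homogeneity of `a`
serves only the grading. -/
theorem IsNilradicalExtension.isIdeal_sup_span (hL : L.IsNilradicalExtension N) {i : ZMod 2}
    {a : V} (ha : a ∈ L.part i) : L.IsIdeal (N ⊔ ℂ ∙ a) where
  graded := by
    refine le_antisymm (sup_le ?_ ?_) (sup_le inf_le_left inf_le_left)
    · conv_lhs => rw [hL.nilradical.isIdeal.graded]
      exact sup_le_sup (inf_le_inf_right _ le_sup_left) (inf_le_inf_right _ le_sup_left)
    · rw [Submodule.span_singleton_le_iff_mem]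
      have hmem : a ∈ N ⊔ ℂ ∙ a := Submodule.mem_sup_right (Submodule.mem_span_singleton_self a)
      have hi : i = 0 ∨ i = 1 := by
        clear ha
        revert i
        decide
      rcases hi with rfl | rfl
      · exact Submodule.mem_sup_left ⟨hmem, ha⟩
      · exact Submodule.mem_sup_right ⟨hmem, ha⟩
  bracket_left _ _ _ := Submodule.mem_sup_left (hL.bracket_mem_nilradical _ _)
  bracket_right _ _ _ := Submodule.mem_sup_left (hL.bracket_mem_nilradical _ _)

/-- A homogeneous element whose right action on `N` commutes with that of `x₁` and is nilpotent
modulo `[N, x₁]` belongs to the nilradical. -/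
theorem IsNPFrame.mem_of_rmul_pow (hf : L.IsNPFrame N e κ) (hL : L.IsNilradicalExtension N)
    {i : ZMod 2} {a : V} (ha : a ∈ L.part i) (hκ : κ (L.bracket (e .x1) a) = 0) {s : ℕ}
    (hs : ∀ u ∈ N, (L.rmul a ^ s) u ∈ N.map (L.rmul (e .x1))) : a ∈ N := by
  set R := L.rmul (e .x1) with hR
  set D := L.rmul a with hD
  have hRN : ∀ r, ∀ u ∈ N, (R ^ r) u ∈ N := fun r u hu => hL.rmul_pow_mem _ r hu
  have hDN : ∀ r, ∀ u ∈ N, (D ^ r) u ∈ N := fun r u hu => hL.rmul_pow_mem _ r hu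
  have hDR : ∀ u ∈ N, D (R u) = R (D u) := fun u hu => by
    have := hf.bracket_bracket_x1 hL hu ha
    rwa [hκ, zero_smul, zero_add] at this
  have hDRr : ∀ r, ∀ u ∈ N, D ((R ^ r) u) = (R ^ r) (D u) := by
    intro r
    induction r with
    | zero => exact fun u _ => rfl
    | succ r ih =>
      intro u hu
      rw [pow_succ', Module.End.mul_apply, hDR _ (hRN r u hu), ih u hu, Module.End.mul_apply]
  have hRR : ∀ r w, R ((R ^ r) w) = (R ^ r) (R w) := fun r w => by
    rw [← Module.End.mul_apply, ← Module.End.mul_apply, ← pow_succ', ← pow_succ]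
  -- The filtration Rʳ⁺¹N + RʳDᵗN. A product with N raises the power of R, a product with `a` raises
  -- t, and at t = s the hypothesis trades Dˢ for one more R. Nilpotency of R ends the descent.
  let P : ℕ → ℕ → Submodule ℂ V := fun r t => N.map (R ^ (r + 1)) ⊔ N.map (R ^ r * D ^ t)
  have hP : ∀ r t, L.bracketSpan (P r t) (N ⊔ ℂ ∙ a) ≤ P r (t + 1) := by
    intro r t
    refine Submodule.map₂_le.2 fun u hu w hw => ?_
    obtain ⟨_, ⟨u₁, hu₁, rfl⟩, _, ⟨u₂, hu₂, rfl⟩, rfl⟩ := Submodule.mem_sup.1 hu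
    obtain ⟨v, hv, w, hw', rfl⟩ := Submodule.mem_sup.1 hw
    obtain ⟨c, rfl⟩ := Submodule.mem_span_singleton.1 hw'
    rw [Module.End.mul_apply, map_add, map_smul]
    refine add_mem ?_ (Submodule.smul_mem _ _ ?_)
    · rw [hf.bracket_eq (add_mem (hRN _ _ hu₁) (hRN _ _ (hDN _ _ hu₂))) hv]
      refine Submodule.smul_mem _ _ (Submodule.mem_sup_left
        ⟨R u₁ + (D ^ t) u₂, add_mem (hL.bracket_mem_nilradical _ _) (hDN _ _ hu₂), ?_⟩)
      change _ = R _
      simp only [map_add, pow_succ, Module.End.mul_apply, hRR]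
    · change D _ ∈ _
      rw [map_add, hDRr _ _ hu₁, hDRr _ _ (hDN _ _ hu₂)]
      refine add_mem (Submodule.mem_sup_left ⟨D u₁, hL.bracket_mem_nilradical _ _, rfl⟩)
        (Submodule.mem_sup_right ⟨u₂, hu₂, ?_⟩)
      rw [pow_succ', Module.End.mul_apply, Module.End.mul_apply]
  have hPs : ∀ r, P r s ≤ P (r + 1) 0 := by
    intro r
    refine le_sup_of_le_right (sup_le (by simp) ?_)
    rintro _ ⟨u, hu, rfl⟩
    obtain ⟨w, hw, hw'⟩ := hs u hu
    refine ⟨w, hw, ?_⟩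
    rw [pow_zero, mul_one, pow_succ, Module.End.mul_apply, Module.End.mul_apply, hw']
  obtain ⟨q, hq⟩ := hf.exists_rmul_x1_pow_eq_zero
  have hmono : ∀ {A B : Submodule ℂ V}, A ≤ B →
      L.bracketSpan A (N ⊔ ℂ ∙ a) ≤ L.bracketSpan B (N ⊔ ℂ ∙ a) :=
    fun h => Submodule.map₂_le_map₂_left h
  have hC : ∀ r t, L.centralSeq (N ⊔ ℂ ∙ a) (1 + r * s) ≤ P r 0 →
      L.centralSeq (N ⊔ ℂ ∙ a) (1 + r * s + t) ≤ P r t := by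
    intro r t h
    induction t with
    | zero => exact h
    | succ t ih => exact (hmono ih).trans (hP r t)
  -- The index is shifted by 1 because the central sequence starts outside N and enters it after one
  -- product.
  have hC' : ∀ r, L.centralSeq (N ⊔ ℂ ∙ a) (1 + r * s) ≤ P r 0 := by
    intro r
    induction r with
    | zero =>
      rw [zero_mul, add_zero]
      refine Submodule.map₂_le.2 fun x _ y _ => Submodule.mem_sup_right
        ⟨L.bracket x y, hL.bracket_mem_nilradical _ _, rfl⟩
    | succ r ih =>
      have := (hC r s ih).trans (hPs r)
      rwa [add_assoc, ← Nat.succ_mul] at this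
  have hnil : L.IsNilpotentSub (N ⊔ ℂ ∙ a) := by
    refine ⟨1 + q * s, le_bot_iff.1 ((hC' q).trans (sup_le ?_ ?_))⟩
    · rintro _ ⟨u, hu, rfl⟩
      rw [pow_succ', Module.End.mul_apply, hq u hu, map_zero]
      exact zero_mem _
    · rintro _ ⟨u, hu, rfl⟩
      rw [pow_zero, mul_one, hq u hu]
      exact zero_mem _
  exact hL.nilradical.largest _ (hL.isIdeal_sup_span ha) hnil
    (Submodule.mem_sup_right (Submodule.mem_span_singleton_self a))

theorem IsNPFrame.mem_of_bracket_eq_zero (hf : L.IsNPFrame N e κ) (hL : L.IsNilradicalExtension N)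
    {i : ZMod 2} {a : V} (ha : a ∈ L.part i) (h : ∀ b, L.bracket (e b) a = 0) : a ∈ N := by
  refine hf.mem_of_rmul_pow hL ha (by rw [h, map_zero]) (s := 1) fun u hu => ?_
  have : u ∈ LinearMap.ker (L.rmul a) := by
    rw [← hf.span_eq] at hu
    refine Submodule.span_le.2 ?_ hu
    rintro _ ⟨b, rfl⟩
    exact h b
  rw [pow_one, LinearMap.mem_ker.1 this]
  exact zero_mem _

/-- For odd y the super sign gives [u,[y,y]] = 2[[u,y],y], and the left side is a multiple of
[u,x₁]. So the square of right multiplication by y maps N into [N,x₁], and y has weight 0 on x₁ by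
parity. -/
theorem IsNPFrame.odd_le (hf : L.IsNPFrame N e κ) (hk : 1 ≤ k) (hn : ∀ j, 2 ≤ n j)
    (hL : L.IsNilradicalExtension N) : L.part 1 ≤ N := by
  intro y hy
  refine hf.mem_of_rmul_pow hL hy
    (hf.κ_eq_zero_of_odd hk hn (hL.bracket_mem_nilradical _ _) ?_) (s := 2) fun u hu => ?_
  · simpa using L.bracket_mem 0 1 _ hf.x1_mem_part _ hy
  · have h := hL.leibniz 1 1 u y hy y hy
    have h1 : (1 : ZMod 2).val = 1 := rfl
    rw [h1, mul_one, pow_one, neg_one_smul, sub_neg_eq_add, ← two_smul ℂ,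
      hf.bracket_eq hu (hL.bracket_mem_nilradical y y)] at h
    refine ⟨(2⁻¹ * κ (L.bracket y y)) • u, Submodule.smul_mem _ _ hu, ?_⟩
    rw [map_smul, pow_two, Module.End.mul_apply, mul_smul]
    simp only [rmul_apply]
    rw [h, smul_smul, inv_mul_cancel₀ two_ne_zero, one_smul]

/-- If an even element acts on `x₁` and on both blocks modulo `[N, x₁]` nilpotently, it belongs to
the nilradical. -/
theorem IsNPFrame.mem_of_isNilpotent (hf : L.IsNPFrame N e κ) (hk : 1 ≤ k) (hn : ∀ j, 2 ≤ n j)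
    (hL : L.IsNilradicalExtension N) {a : V} (ha : a ∈ L.part 0)
    (hκ : κ (L.bracket (e .x1) a) = 0) {s : ℕ}
    (hs : ∀ ε, ∀ z ∈ L.blockPart N κ ε, (L.rmul a ^ s) z ∈ N.map (L.rmul (e .x1))) : a ∈ N := by
  have hinv : ∀ ε, ∀ z ∈ L.blockPart N κ ε, L.rmul a z ∈ L.blockPart N κ ε :=
    fun ε z hz => hf.bracket_even_mem_blockPart hk hn hL hz ha
  -- The additional application of `a` moves x₁ into the even blocks, where the hypothesis applies.
  refine hf.mem_of_rmul_pow hL ha hκ (s := s + 1) fun u hu => ?_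
  obtain ⟨z₀, h₀, z₁, h₁, h⟩ := hf.exists_eq_add_blockPart hu
  rw [pow_succ, Module.End.mul_apply, h]
  simp only [map_add, map_smul]
  have hx : L.rmul a (e .x1) ∈ L.blockPart N κ 0 :=
    mem_blockPart.2 ⟨hL.bracket_mem_nilradical _ _, hκ,
      L.bracket_mem_even_right hf.x1_mem_part ha⟩
  exact add_mem (add_mem (Submodule.smul_mem _ _ (hs _ _ hx)) (hs _ _ (hinv _ _ h₀)))
    (hs _ _ (hinv _ _ h₁))

/-! ### Weights of the even part modulo [N,x₁] -/

theorem IsNPFrame.blockAction_shift (hf : L.IsNPFrame N e κ) (hL : L.IsNilradicalExtension N)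
    {ε : ZMod 2} (h : ∀ z ∈ L.blockPart N κ ε, ∀ a ∈ L.part 0, L.bracket z a ∈ L.blockPart N κ ε)
    (a : L.part 0) (z : L.blockPart N κ ε) :
    L.blockAction N κ ε h a (L.blockAction N κ ε h ⟨e .x1, hf.x1_mem_part⟩ z) =
      L.blockAction N κ ε h ⟨e .x1, hf.x1_mem_part⟩ (L.blockAction N κ ε h a z) +
        κ (L.bracket (e .x1) a) • L.blockAction N κ ε h ⟨e .x1, hf.x1_mem_part⟩ z := by
  ext
  simp only [coe_blockAction_apply, Submodule.coe_add, Submodule.coe_smul]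
  rw [hf.bracket_bracket_x1 hL (mem_blockPart.1 z.2).1 a.2, add_comm]

/-- The action of the even part of `L` on a block modulo `[N, x₁]` has eigenvalues depending
linearly on the element. -/
theorem IsNPFrame.exists_block_weights [FiniteDimensional ℂ V] (hf : L.IsNPFrame N e κ)
    (hL : L.IsNilradicalExtension N) {ε : ZMod 2}
    (h : ∀ z ∈ L.blockPart N κ ε, ∀ a ∈ L.part 0, L.bracket z a ∈ L.blockPart N κ ε) {q : ℕ}
    (hq : finrank ℂ (L.blockPart N κ ε ⧸
      LinearMap.range (L.blockAction N κ ε h ⟨e .x1, hf.x1_mem_part⟩)) = q) :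
    ∃ χ : Fin q → (L.part 0 →ₗ[ℂ] ℂ), ∀ a, ∃ Q : End ℂ (L.blockPart N κ ε ⧸
      LinearMap.range (L.blockAction N κ ε h ⟨e .x1, hf.x1_mem_part⟩)),
      (∀ z, Q (Submodule.mkQ _ z) = Submodule.mkQ _ (L.blockAction N κ ε h a z)) ∧
        ∀ μ, Q.HasEigenvalue μ ↔ ∃ i, χ i a = μ := by
  set φ := L.blockAction N κ ε h with hφ
  set R := φ ⟨e .x1, hf.x1_mem_part⟩ with hR
  set W := LinearMap.range R with hW
  have hinv : ∀ a, W ≤ W.comap (φ a) := by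
    rintro a _ ⟨z, rfl⟩
    rw [Submodule.mem_comap, hR, hf.blockAction_shift hL]
    exact add_mem ⟨_, rfl⟩ (Submodule.smul_mem _ _ ⟨_, rfl⟩)
  let ψ : L.part 0 →ₗ[ℂ] End ℂ (L.blockPart N κ ε ⧸ W) :=
    { toFun := fun a => W.mapQ W (φ a) (hinv a)
      map_add' := fun a b => by ext x; simp
      map_smul' := fun c a => by ext x; simp }
  have hψ : ∀ a z, ψ a (W.mkQ z) = W.mkQ (φ a z) := fun a z => rfl
  -- The commutator of the actions of a and b is right multiplication by [b,a] ∈ N, a multiple of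
  -- right multiplication by x₁, so it vanishes on the quotient.
  obtain ⟨χ, hχ⟩ := exists_linear_eigenvalues q (L.blockPart N κ ε ⧸ W) hq ψ fun a b => by
    refine LinearMap.ext fun x => ?_
    obtain ⟨z, rfl⟩ := W.mkQ_surjective x
    rw [Module.End.mul_apply, Module.End.mul_apply, hψ, hψ, hψ, hψ, ← sub_eq_zero, ← map_sub,
      Submodule.mkQ_apply, Submodule.Quotient.mk_eq_zero]
    refine ⟨κ (L.bracket b a) • z, ?_⟩
    ext
    rw [map_smul]
    simp only [hR, hφ, coe_blockAction_apply, Submodule.coe_smul, Submodule.coe_sub]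
    rw [← hf.bracket_eq (mem_blockPart.1 z.2).1 (hL.bracket_mem_nilradical _ _),
      hL.leibniz.bracket_bracket_even_left _ b.2 a.2]
  exact ⟨χ, fun a => ⟨ψ a, hψ a, hχ a⟩⟩

/-- All large exponents are allowed so that the two parities can share one. -/
theorem IsNPFrame.exists_pow_mem_of_eigenvalue_eq_zero [FiniteDimensional ℂ V]
    (hf : L.IsNPFrame N e κ) {ε : ZMod 2}
    (h : ∀ z ∈ L.blockPart N κ ε, ∀ a ∈ L.part 0, L.bracket z a ∈ L.blockPart N κ ε)
    {a : L.part 0} {Q : End ℂ (L.blockPart N κ ε ⧸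
      LinearMap.range (L.blockAction N κ ε h ⟨e .x1, hf.x1_mem_part⟩))}
    (hQ : ∀ z, Q (Submodule.mkQ _ z) = Submodule.mkQ _ (L.blockAction N κ ε h a z))
    (hQ0 : ∀ μ, Q.HasEigenvalue μ → μ = 0) :
    ∃ s, ∀ r, s ≤ r → ∀ z ∈ L.blockPart N κ ε,
      (L.rmul a ^ r) z ∈ N.map (L.rmul (e .x1)) := by
  obtain ⟨s, hs⟩ := isNilpotent_of_forall_hasEigenvalue Q hQ0
  refine ⟨s, fun r hr z hz => ?_⟩
  have hpow : ∀ (r : ℕ) (z : L.blockPart N κ ε), (Q ^ r) (Submodule.mkQ _ z) =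
      Submodule.mkQ _ ((L.blockAction N κ ε h a ^ r) z) := by
    intro r
    induction r with
    | zero => exact fun _ => rfl
    | succ r ih =>
      intro z
      rw [pow_succ, pow_succ, Module.End.mul_apply, Module.End.mul_apply, hQ, ih]
  have hcoe : ∀ (r : ℕ) (z : L.blockPart N κ ε),
      ((L.blockAction N κ ε h a ^ r) z : V) = (L.rmul a ^ r) z := by
    intro r
    induction r with
    | zero => exact fun _ => rfl
    | succ r ih =>
      intro z
      rw [pow_succ, pow_succ, Module.End.mul_apply, Module.End.mul_apply, ih]
      rfl
  have h1 := hpow r ⟨z, hz⟩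
  obtain ⟨d, rfl⟩ := Nat.exists_eq_add_of_le' hr
  rw [pow_add Q, hs, mul_zero, LinearMap.zero_apply, eq_comm, Submodule.mkQ_apply,
    Submodule.Quotient.mk_eq_zero] at h1
  obtain ⟨w, hw⟩ := h1
  refine ⟨w, (mem_blockPart.1 w.2).1, ?_⟩
  rw [← hcoe _ ⟨z, hz⟩, ← hw]
  rfl

/-- If `L` is large enough, some even element acts on `x₁` with weight `1`, and on both blocks
modulo `[N, x₁]` with arbitrary prescribed eigenvalues. -/
theorem IsNPFrame.exists_even_of_weights [FiniteDimensional ℂ V] (hf : L.IsNPFrame N e κ)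
    (hk : 1 ≤ k) (hn : ∀ j, 2 ≤ n j) (hm : ∀ j, 2 ≤ m j) (hL : L.IsNilradicalExtension N)
    (hdim : finrank ℂ N + (1 + (k + p)) ≤ finrank ℂ V)
    (h : ∀ ε, ∀ z ∈ L.blockPart N κ ε, ∀ a ∈ L.part 0, L.bracket z a ∈ L.blockPart N κ ε)
    (c : Fin k → ℂ) (d : Fin p → ℂ) :
    ∃ t : L.part 0, κ (L.bracket (e .x1) t) = 1 ∧
      (∃ Q : End ℂ (L.blockPart N κ 0 ⧸
        LinearMap.range (L.blockAction N κ 0 (h 0) ⟨e .x1, hf.x1_mem_part⟩)),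
        (∀ z, Q (Submodule.mkQ _ z) = Submodule.mkQ _ (L.blockAction N κ 0 (h 0) t z)) ∧
          ∀ j, Q.HasEigenvalue (c j)) ∧
      (∃ Q : End ℂ (L.blockPart N κ 1 ⧸
        LinearMap.range (L.blockAction N κ 1 (h 1) ⟨e .x1, hf.x1_mem_part⟩)),
        (∀ z, Q (Submodule.mkQ _ z) = Submodule.mkQ _ (L.blockAction N κ 1 (h 1) t z)) ∧
          ∀ j, Q.HasEigenvalue (d j)) := by
  obtain ⟨b₀, hb₀⟩ := hf.exists_chainBasis_zero (h 0)
  obtain ⟨b₁, hb₁⟩ := hf.exists_chainBasis_one (h 1)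
  obtain ⟨χ₀, hχ₀⟩ := hf.exists_block_weights hL (h 0)
    (hb₀.finrank_quotient fun j => le_trans (by norm_num) (hn j))
  obtain ⟨χ₁, hχ₁⟩ := hf.exists_block_weights hL (h 1)
    (hb₁.finrank_quotient fun j => le_trans (by norm_num) (hm j))
  let χ : L.part 0 →ₗ[ℂ] ℂ := κ ∘ₗ L.bracket (e .x1) ∘ₗ (L.part 0).subtype
  let Ψ : L.part 0 →ₗ[ℂ] (Unit ⊕ (Fin k ⊕ Fin p) → ℂ) :=
    LinearMap.pi (Sum.elim (fun _ => χ) (Sum.elim χ₀ χ₁))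
  let g : L.part 0 →ₗ[ℂ] V ⧸ N := N.mkQ ∘ₗ (L.part 0).subtype
  -- An even element with all weights zero belongs to N.
  have hker : LinearMap.ker Ψ ≤ LinearMap.ker g := by
    intro a ha
    have ha' : ∀ i, Ψ a i = 0 := fun i => congrFun (LinearMap.mem_ker.1 ha) i
    rw [LinearMap.mem_ker, LinearMap.comp_apply, Submodule.mkQ_apply,
      Submodule.Quotient.mk_eq_zero]
    obtain ⟨Q₀, hQ₀, hQ₀'⟩ := hχ₀ a
    obtain ⟨Q₁, hQ₁, hQ₁'⟩ := hχ₁ a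
    obtain ⟨s₀, hs₀⟩ := hf.exists_pow_mem_of_eigenvalue_eq_zero (h 0) hQ₀ fun μ hμ => by
      obtain ⟨i, rfl⟩ := (hQ₀' μ).1 hμ
      exact ha' (.inr (.inl i))
    obtain ⟨s₁, hs₁⟩ := hf.exists_pow_mem_of_eigenvalue_eq_zero (h 1) hQ₁ fun μ hμ => by
      obtain ⟨i, rfl⟩ := (hQ₁' μ).1 hμ
      exact ha' (.inr (.inr i))
    refine hf.mem_of_isNilpotent hk hn hL a.2 (ha' (.inl ())) (s := max s₀ s₁) fun ε => ?_
    have hε : ε = 0 ∨ ε = 1 := by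
      revert ε
      decide
    rcases hε with rfl | rfl
    · exact hs₀ _ (le_max_left _ _)
    · exact hs₁ _ (le_max_right _ _)
  have hg : Function.Surjective g := by
    intro x
    obtain ⟨v, rfl⟩ := N.mkQ_surjective x
    obtain ⟨v₀, h₀, v₁, h₁, rfl⟩ := L.exists_parts v
    refine ⟨⟨v₀, h₀⟩, ?_⟩
    have : N.mkQ v₁ = 0 := (Submodule.Quotient.mk_eq_zero N).2 (hf.odd_le hk hn hL h₁)
    rw [map_add, this, add_zero]
    rfl
  -- The rank of `Ψ` is at least that of `g`, which is the codimension of N and hence at least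
  -- 1+k+p, the dimension of the target.
  have hΨ : Function.Surjective Ψ := by
    rw [← LinearMap.range_eq_top]
    apply Submodule.eq_top_of_finrank_eq
    refine le_antisymm (Submodule.finrank_le _) ?_
    have h1 := LinearMap.finrank_range_add_finrank_ker Ψ
    have h2 := LinearMap.finrank_range_add_finrank_ker g
    rw [LinearMap.range_eq_top.2 hg, finrank_top] at h2
    have h3 := Submodule.finrank_quotient_add_finrank N
    have h4 := Submodule.finrank_mono hker
    have h5 : finrank ℂ (Unit ⊕ (Fin k ⊕ Fin p) → ℂ) = 1 + (k + p) := by simp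
    omega
  obtain ⟨t, ht⟩ := hΨ (Sum.elim (fun _ => 1) (Sum.elim c d))
  have ht' : ∀ i, Ψ t i = Sum.elim (fun _ => 1) (Sum.elim c d) i := fun i => congrFun ht i
  obtain ⟨Q₀, hQ₀, hQ₀'⟩ := hχ₀ t
  obtain ⟨Q₁, hQ₁, hQ₁'⟩ := hχ₁ t
  exact ⟨t, ht' (.inl ()), ⟨Q₀, hQ₀, fun j => (hQ₀' _).2 ⟨j, ht' (.inr (.inl j))⟩⟩,
    ⟨Q₁, hQ₁, fun j => (hQ₁' _).2 ⟨j, ht' (.inr (.inr j))⟩⟩⟩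

/-! ### A basis of the nilradical diagonal for one generic even element -/

theorem IsNPFrame.exists_block_eigenbasis [FiniteDimensional ℂ V] (hf : L.IsNPFrame N e κ)
    (hL : L.IsNilradicalExtension N) {ε : ZMod 2}
    (h : ∀ z ∈ L.blockPart N κ ε, ∀ a ∈ L.part 0, L.bracket z a ∈ L.blockPart N κ ε) {q : ℕ}
    {l : Fin q → ℕ} (hl : ∀ j, 2 ≤ l j) {b : Basis (Σ j, Fin (l j)) ℂ (L.blockPart N κ ε)}
    (hb : IsChainBasis (L.blockAction N κ ε h ⟨e .x1, hf.x1_mem_part⟩) b) {t : L.part 0}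
    (ht : κ (L.bracket (e .x1) t) = 1) {c : Fin q → ℂ}
    (hcinj : ∀ j j' (i i' : ℕ), c j + i = c j' + i' → j = j')
    (hQ : ∃ Q : End ℂ (L.blockPart N κ ε ⧸
      LinearMap.range (L.blockAction N κ ε h ⟨e .x1, hf.x1_mem_part⟩)),
      (∀ z, Q (Submodule.mkQ _ z) = Submodule.mkQ _ (L.blockAction N κ ε h t z)) ∧
        ∀ j, Q.HasEigenvalue (c j)) :
    ∃ (σ : Equiv.Perm (Fin q)) (X : (j : Fin q) → Fin (l j) → V),
      Submodule.span ℂ (Set.range fun s : Σ j, Fin (l j) => X s.1 s.2) = L.blockPart N κ ε ∧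
      (LinearIndependent ℂ fun s : Σ j, Fin (l j) => X s.1 s.2) ∧
      (∀ j i, L.bracket (X j i) (e .x1) =
        if h : i.val + 1 < l j then X j ⟨i.val + 1, h⟩ else 0) ∧
      ∀ j i, L.bracket (X j i) t = (c (σ j) + i.val) • X j i := by
  obtain ⟨Q, hQ, hQc⟩ := hQ
  -- Weight 1 on x₁ makes the shift relation exactly DR = RD + R.
  obtain ⟨σ, X, hX, hXD⟩ := exists_chain_eigenbasis (R := L.blockAction N κ ε h
    ⟨e .x1, hf.x1_mem_part⟩) (D := L.blockAction N κ ε h t) (fun v => by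
      rw [hf.blockAction_shift hL, ht, one_smul]) (fun j => le_trans (by norm_num) (hl j)) hb
      Q hQ c hQc hcinj
  refine ⟨σ, fun j i => X ⟨j, i⟩, ?_, ?_, fun j i => ?_, fun j i => ?_⟩
  · have := congrArg (Submodule.map (L.blockPart N κ ε).subtype) X.span_eq
    rw [Submodule.map_span, ← Set.range_comp, Submodule.map_top, Submodule.range_subtype] at this
    exact this
  · exact X.linearIndependent.map' (L.blockPart N κ ε).subtype (Submodule.ker_subtype _)
  · have := congrArg Subtype.val (hX j i)
    rw [coe_blockAction_apply] at this
    rw [this]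
    split_ifs <;> rfl
  · exact congrArg Subtype.val (hXD j i)

/-- The eigenvalues chosen for a generic even element: the imaginary part determines the block and
the real part the position in the block. -/
noncomputable def genericWeight (σ : Equiv.Perm (Fin k)) (τ : Equiv.Perm (Fin p)) :
    NPIndex n m → ℂ
  | .x1 => 1
  | .x j i => ((σ j).val + 1 : ℝ) * Complex.I + i.val
  | .y j i => -((τ j).val + 1 : ℝ) * Complex.I + i.val

theorem genericWeight_ne_zero (σ : Equiv.Perm (Fin k)) (τ : Equiv.Perm (Fin p))
    (a : NPIndex n m) : genericWeight σ τ a ≠ 0 := by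
  intro h
  cases a with
  | x1 => simp [genericWeight] at h
  | x j i =>
    have := congrArg Complex.im h
    simp [genericWeight] at this
    norm_cast at this
  | y j i =>
    have := congrArg Complex.im h
    simp [genericWeight] at this
    have h' : (0 : ℝ) ≤ ((τ j).val : ℝ) := Nat.cast_nonneg _
    linarith

/-- The imaginary part is zero at x₁, positive on even blocks and negative on odd ones. -/
theorem genericWeight_injective (σ : Equiv.Perm (Fin k)) (τ : Equiv.Perm (Fin p)) :
    Function.Injective (genericWeight σ τ : NPIndex n m → ℂ) := by
  have hpos : ∀ r : ℕ, (0 : ℝ) ≤ r := fun r => Nat.cast_nonneg _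
  intro a b h
  have him := congrArg Complex.im h
  have hre := congrArg Complex.re h
  cases a with
  | x1 =>
    cases b with
    | x1 => rfl
    | x j i => simp [genericWeight] at him; linarith [hpos (σ j).val]
    | y j i => simp [genericWeight] at him; linarith [hpos (τ j).val]
  | x j i =>
    cases b with
    | x1 => simp [genericWeight] at him; linarith [hpos (σ j).val]
    | x j' i' =>
      simp [genericWeight] at him hre
      obtain rfl : j = j' := σ.injective (Fin.ext him)
      rw [Fin.ext hre]
    | y j' i' => simp [genericWeight] at him; linarith [hpos (σ j).val, hpos (τ j').val]
  | y j i =>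
    cases b with
    | x1 => simp [genericWeight] at him; linarith [hpos (τ j).val]
    | x j' i' => simp [genericWeight] at him; linarith [hpos (σ j').val, hpos (τ j).val]
    | y j' i' =>
      simp [genericWeight] at him hre
      obtain rfl : j = j' := τ.injective (Fin.ext him)
      rw [Fin.ext hre]

/-- If `L` is large enough, `N` has a frame of eigenvectors for the right multiplication by some
even element, with distinct nonzero eigenvalues. -/
theorem IsNPFrame.exists_eigenframe [FiniteDimensional ℂ V] (hf : L.IsNPFrame N e κ)
    (hk : 1 ≤ k) (hn : ∀ j, 2 ≤ n j) (hm : ∀ j, 2 ≤ m j) (hL : L.IsNilradicalExtension N)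
    (hdim : finrank ℂ N + (1 + (k + p)) ≤ finrank ℂ V) :
    ∃ (e' : NPIndex n m → V) (μ : NPIndex n m → ℂ), ∃ t ∈ L.part 0, L.IsNPFrame N e' κ ∧
      Function.Injective μ ∧ (∀ a, μ a ≠ 0) ∧ ∀ a, L.bracket (e' a) t = μ a • e' a := by
  have h : ∀ ε, ∀ z ∈ L.blockPart N κ ε, ∀ a ∈ L.part 0, L.bracket z a ∈ L.blockPart N κ ε :=
    fun ε z hz a ha => hf.bracket_even_mem_blockPart hk hn hL hz ha
  -- Positions add only natural numbers to a weight, so distinct imaginary parts keep the blocks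
  -- apart.
  let c : Fin k → ℂ := fun j => (j.val + 1 : ℝ) * Complex.I
  let d : Fin p → ℂ := fun j => -(j.val + 1 : ℝ) * Complex.I
  have hc : ∀ j j' (i i' : ℕ), c j + i = c j' + i' → j = j' := fun j j' i i' h => by
    have := congrArg Complex.im h
    simp [c] at this
    exact Fin.ext this
  have hd : ∀ j j' (i i' : ℕ), d j + i = d j' + i' → j = j' := fun j j' i i' h => by
    have := congrArg Complex.im h
    simp [d] at this
    exact Fin.ext this
  obtain ⟨t, ht, hQ₀, hQ₁⟩ := hf.exists_even_of_weights hk hn hm hL hdim h c d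
  obtain ⟨b₀, hb₀⟩ := hf.exists_chainBasis_zero (h 0)
  obtain ⟨b₁, hb₁⟩ := hf.exists_chainBasis_one (h 1)
  obtain ⟨σ, X, hXspan, hXind, hXR, hXt⟩ :=
    hf.exists_block_eigenbasis hL (h 0) hn hb₀ ht hc hQ₀
  obtain ⟨τ, Y, hYspan, hYind, hYR, hYt⟩ :=
    hf.exists_block_eigenbasis hL (h 1) hm hb₁ ht hd hQ₁
  have hX : ∀ j i, X j i ∈ L.blockPart N κ 0 := fun j i =>
    hXspan ▸ Submodule.subset_span ⟨⟨j, i⟩, rfl⟩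
  have hY : ∀ j i, Y j i ∈ L.blockPart N κ 1 := fun j i =>
    hYspan ▸ Submodule.subset_span ⟨⟨j, i⟩, rfl⟩
  have hXμ : ∀ (s : Σ j, Fin (n j)) (r : ℝ), c (σ s.1) + s.2.val ≠ r := fun s r h => by
    have := congrArg Complex.im h
    simp [c] at this
    norm_cast at this
  -- All eigenvalues of `t` on the even blocks are non-real. This is used below for the real values
  -- 1 and 2.
  have hinj : ∀ (r : ℝ), ∀ z ∈ L.blockPart N κ 0, L.bracket z t = (r : ℂ) • z → z = 0 :=
    fun r z hz hzt => eq_zero_of_eigenvector (L.rmul t) hXind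
      (fun s => c (σ s.1) + s.2.val) (fun s => hXt s.1 s.2) (fun s => hXμ s r)
      (hXspan.symm ▸ hz) hzt
  -- The defect [x₁,t] − x₁ lies in the even blocks, where right multiplication by `t` minus the
  -- identity is invertible; subtracting `w` makes x₁ an eigenvector of eigenvalue 1.
  obtain ⟨w, hw, hwt⟩ : ∃ w ∈ L.blockPart N κ 0,
      L.bracket w t - w = L.bracket (e .x1) t - e .x1 := by
    let f : End ℂ (L.blockPart N κ 0) := L.blockAction N κ 0 (h 0) t - 1
    have hf' : Function.Injective f := by
      rw [← LinearMap.ker_eq_bot, LinearMap.ker_eq_bot']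
      intro z hz
      have h1 : L.bracket z t - z = 0 := congrArg Subtype.val hz
      exact Subtype.ext (hinj 1 z z.2 (by simpa using sub_eq_zero.1 h1))
    have hmem : L.bracket (e .x1) t - e .x1 ∈ L.blockPart N κ 0 :=
      mem_blockPart.2 ⟨sub_mem (hL.bracket_mem_nilradical _ _) (hf.mem _),
        by rw [map_sub, ht, hf.κ_x1, sub_self],
        sub_mem (L.bracket_mem_even_right hf.x1_mem_part t.2) hf.x1_mem_part⟩
    obtain ⟨w, hw⟩ := LinearMap.injective_iff_surjective.1 hf' ⟨_, hmem⟩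
    exact ⟨w, w.2, congrArg Subtype.val hw⟩
  obtain ⟨hwN, hwκ, hwp⟩ := mem_blockPart.1 hw
  obtain ⟨e', hex1, hex, hey⟩ : ∃ e' : NPIndex n m → V, e' .x1 = e .x1 - w ∧
      (∀ j i, e' (.x j i) = X j i) ∧ ∀ j i, e' (.y j i) = Y j i :=
    ⟨fun a => match a with
      | .x1 => e .x1 - w
      | .x j i => X j i
      | .y j i => Y j i, rfl, fun _ _ => rfl, fun _ _ => rfl⟩
  have hx1t : L.bracket (e .x1 - w) t = e .x1 - w := by
    rw [map_sub, LinearMap.sub_apply, sub_eq_sub_iff_sub_eq_sub.1 hwt.symm]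
  have hx1N : e .x1 - w ∈ N := sub_mem (hf.mem _) hwN
  have hx1p : e .x1 - w ∈ L.part 0 := sub_mem hf.x1_mem_part hwp
  have hmem : ∀ a, e' a ∈ N := fun a => match a with
    | .x1 => hex1 ▸ hx1N
    | .x j i => hex j i ▸ (mem_blockPart.1 (hX j i)).1
    | .y j i => hey j i ▸ (mem_blockPart.1 (hY j i)).1
  have hκx1 : κ (e' .x1) = 1 := by rw [hex1, map_sub, hf.κ_x1, hwκ, sub_zero]
  have hκx : ∀ j i, κ (e' (.x j i)) = 0 := fun j i => hex j i ▸ (mem_blockPart.1 (hX j i)).2.1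
  have hκy : ∀ j i, κ (e' (.y j i)) = 0 := fun j i => hey j i ▸ (mem_blockPart.1 (hY j i)).2.1
  -- By the Leibniz identity this square has eigenvalue 1 + 1 = 2 under `t`, while it lies in the
  -- even blocks, where no real eigenvalue occurs.
  have hx1x1 : L.bracket (e .x1 - w) (e .x1 - w) = 0 := by
    refine hinj 2 _ (mem_blockPart.2 ⟨hL.bracket_mem_nilradical _ _, ?_, ?_⟩) ?_
    · have := (mem_blockPart.1 (h 0 w hw _ hf.x1_mem_part)).2.1
      rw [hf.bracket_eq hx1N hx1N, map_sub L.bracket, LinearMap.sub_apply, hf.bracket_x1_x1,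
        zero_sub, map_smul, map_neg, this, neg_zero, smul_zero]
    · exact L.bracket_mem_even_right hx1p hx1p
    · have := hL.leibniz.bracket_bracket_even_left (e .x1 - w) hx1p t.2
      rw [hx1t] at this
      rw [eq_add_of_sub_eq this.symm, ← two_smul ℂ]
      simp
  have hμ := genericWeight_injective (n := n) (m := m) σ τ
  have hμt : ∀ a, L.bracket (e' a) t = genericWeight σ τ a • e' a := fun a => match a with
    | .x1 => by rw [hex1, genericWeight, one_smul, hx1t]
    | .x j i => by rw [hex, hXt]; rfl
    | .y j i => by rw [hey, hYt]; rfl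
  have hne : ∀ a, e' a ≠ 0 := fun a => match a with
    | .x1 => fun h0 => by
      rw [h0, map_zero] at hκx1
      exact zero_ne_one hκx1
    | .x j i => hex j i ▸ hXind.ne_zero ⟨j, i⟩
    | .y j i => hey j i ▸ hYind.ne_zero ⟨j, i⟩
  refine ⟨e', genericWeight σ τ, t, t.2, ?_, hμ, genericWeight_ne_zero σ τ, hμt⟩
  exact
  { indep := Module.End.eigenvectors_linearIndependent' (L.rmul t) _ hμ e' fun a =>
      ⟨Module.End.mem_eigenspace_iff.2 (hμt a), hne a⟩
    span_eq := by
      refine le_antisymm (Submodule.span_le.2 ?_) fun v hv => ?_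
      · rintro _ ⟨a, rfl⟩
        exact hmem a
      · have h0 : L.blockPart N κ 0 ≤ Submodule.span ℂ (Set.range e') := by
          rw [← hXspan]
          refine Submodule.span_mono ?_
          rintro _ ⟨s, rfl⟩
          exact ⟨.x s.1 s.2, hex _ _⟩
        have h1 : L.blockPart N κ 1 ≤ Submodule.span ℂ (Set.range e') := by
          rw [← hYspan]
          refine Submodule.span_mono ?_
          rintro _ ⟨s, rfl⟩
          exact ⟨.y s.1 s.2, hey _ _⟩
        obtain ⟨z₀, hz₀, z₁, hz₁, hz⟩ := hf.exists_eq_add_blockPart hv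
        rw [hz]
        refine add_mem (add_mem (Submodule.smul_mem _ _ ?_) (h0 hz₀)) (h1 hz₁)
        have : e' .x1 + w ∈ Submodule.span ℂ (Set.range e') :=
          add_mem (Submodule.subset_span ⟨.x1, rfl⟩) (h0 hw)
        rwa [hex1, sub_add_cancel] at this
    mem_part := fun a => match a with
      | .x1 => hex1 ▸ hx1p
      | .x j i => hex j i ▸ (mem_blockPart.1 (hX j i)).2.2
      | .y j i => hey j i ▸ (mem_blockPart.1 (hY j i)).2.2
    -- The corrected x₁ still has κ = 1, so its right action on N is the old one.
    bracket_x1_right := fun a => match a with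
      | .x1 => by
        rw [NPIndex.table, map_zero, hex1, hx1x1]
        all_goals simp
      | .x j i => by
        rw [hf.bracket_eq (hmem _) (hmem _), hκx1, one_smul, NPIndex.table, hex, hXR]
        split_ifs <;> simp [hex]
      | .y j i => by
        rw [hf.bracket_eq (hmem _) (hmem _), hκx1, one_smul, NPIndex.table, hey, hYR]
        split_ifs <;> simp [hey]
    bracket_x := fun a j i => by
      rw [hf.bracket_eq (hmem _) (hmem _), hκx, zero_smul]
    bracket_y := fun a j i => by
      rw [hf.bracket_eq (hmem _) (hmem _), hκy, zero_smul]
    κ_x1 := hκx1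
    κ_x := hκx
    κ_y := hκy }

/-! ### The complementary torus and its left and right weights -/

theorem IsLeibniz.bracket_bracket_of_right_even (hL : L.IsLeibniz) (x y : V) {z : V}
    (hz : z ∈ L.part 0) : L.bracket x (L.bracket y z) =
      L.bracket (L.bracket x y) z - L.bracket (L.bracket x z) y := by
  obtain ⟨y₀, h₀, y₁, h₁, rfl⟩ := L.exists_parts y
  simp only [map_add, LinearMap.add_apply, hL.bracket_bracket_even_right x h₀ hz,
    hL.bracket_bracket_even_right x h₁ hz]
  abel

theorem IsLeibniz.bracket_bracket_of_left_even (hL : L.IsLeibniz) (x : V) {y : V} (z : V)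
    (hy : y ∈ L.part 0) : L.bracket x (L.bracket y z) =
      L.bracket (L.bracket x y) z - L.bracket (L.bracket x z) y := by
  obtain ⟨z₀, h₀, z₁, h₁, rfl⟩ := L.exists_parts z
  simp only [map_add, LinearMap.add_apply, hL.bracket_bracket_even_left x hy h₀,
    hL.bracket_bracket_even_left x hy h₁]
  abel

/-- The vectors of the family `e` are eigenvectors of the right multiplication by the even element
`t`, with distinct nonzero eigenvalues `μ`. -/
structure IsDiagonalizedBy (L : ComplexSuperalgebra V) (e : NPIndex n m → V)
    (μ : NPIndex n m → ℂ) (t : V) : Prop where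
  mem_part : t ∈ L.part 0
  injective : Function.Injective μ
  ne_zero : ∀ a, μ a ≠ 0
  bracket_eq : ∀ a, L.bracket (e a) t = μ a • e a

/-- The elements annihilated by the right multiplication by `t`. -/
def leftAnnihilator (L : ComplexSuperalgebra V) (t : V) : Submodule ℂ V :=
  LinearMap.ker (L.rmul t)

theorem mem_leftAnnihilator {t v : V} : v ∈ L.leftAnnihilator t ↔ L.bracket v t = 0 := Iff.rfl

variable {μ : NPIndex n m → ℂ} {t : V}

theorem IsNPFrame.disjoint_leftAnnihilator (hf : L.IsNPFrame N e κ)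
    (ht : L.IsDiagonalizedBy e μ t) : Disjoint N (L.leftAnnihilator t) :=
  Submodule.disjoint_def.2 fun _ hv hv' =>
    eq_zero_of_eigenvector (L.rmul t) hf.indep μ ht.bracket_eq ht.ne_zero (hf.span_eq.symm ▸ hv)
      (by rw [zero_smul]; exact hv')

/-- Right multiplication by `t` sends L into N and is onto already on N, since no eigenvalue there
is zero; so each v differs from some u ∈ N by an annihilated element. -/
theorem IsNPFrame.isCompl_leftAnnihilator (hf : L.IsNPFrame N e κ)
    (hL : L.IsNilradicalExtension N) (ht : L.IsDiagonalizedBy e μ t) :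
    IsCompl N (L.leftAnnihilator t) := by
  refine ⟨hf.disjoint_leftAnnihilator ht, codisjoint_iff_le_sup.2 fun v _ => ?_⟩
  have hN : N ≤ N.map (L.rmul t) := by
    conv_lhs => rw [← hf.span_eq]
    rw [Submodule.span_le]
    rintro _ ⟨a, rfl⟩
    refine ⟨(μ a)⁻¹ • e a, Submodule.smul_mem _ _ (hf.mem a), ?_⟩
    rw [map_smul, rmul_apply, ht.bracket_eq, smul_smul, inv_mul_cancel₀ (ht.ne_zero a), one_smul]
  obtain ⟨u, hu, hut⟩ := hN (hL.bracket_mem_nilradical v t)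
  rw [← add_sub_cancel u v]
  refine add_mem (Submodule.mem_sup_left hu) (Submodule.mem_sup_right ?_)
  rw [mem_leftAnnihilator, map_sub, LinearMap.sub_apply, sub_eq_zero]
  exact hut.symm

/-- As `t` is even, the odd component is annihilated too; it lies in N, where the annihilator is
trivial. -/
theorem IsNPFrame.leftAnnihilator_le_even (hf : L.IsNPFrame N e κ) (hk : 1 ≤ k)
    (hn : ∀ j, 2 ≤ n j) (hL : L.IsNilradicalExtension N) (ht : L.IsDiagonalizedBy e μ t) :
    L.leftAnnihilator t ≤ L.part 0 := by
  intro u hu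
  obtain ⟨u₀, h₀, u₁, h₁, rfl⟩ := L.exists_parts u
  rw [mem_leftAnnihilator, map_add, LinearMap.add_apply] at hu
  have hu₁ : L.bracket u₁ t = 0 := by
    refine L.eq_zero_of_mem_part ?_ (L.bracket_mem_even_right h₁ ht.mem_part)
    rw [eq_neg_of_add_eq_zero_right hu]
    exact neg_mem (L.bracket_mem_even_right h₀ ht.mem_part)
  rw [Submodule.disjoint_def.1 (hf.disjoint_leftAnnihilator ht) u₁ (hf.odd_le hk hn hL h₁) hu₁,
    add_zero]
  exact h₀

/-- The product lies in N and, by the Leibniz identity, is again annihilated by `t`. -/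
theorem IsNPFrame.bracket_leftAnnihilator (hf : L.IsNPFrame N e κ)
    (hL : L.IsNilradicalExtension N) (ht : L.IsDiagonalizedBy e μ t) {u v : V}
    (hu : u ∈ L.leftAnnihilator t) (hv : v ∈ L.leftAnnihilator t) : L.bracket u v = 0 := by
  refine Submodule.disjoint_def.1 (hf.disjoint_leftAnnihilator ht) _
    (hL.bracket_mem_nilradical _ _) ?_
  have h := hL.leibniz.bracket_bracket_of_right_even u v ht.mem_part
  rw [mem_leftAnnihilator] at hu hv ⊢
  rw [hu, hv, map_zero, map_zero, LinearMap.zero_apply, sub_zero] at h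
  exact h.symm

/-- Right multiplication by `u` commutes with that by `t` because [u,t] = 0, and the eigenspaces of
`t` in N are lines. Left multiplication is treated the same way. -/
theorem IsNPFrame.exists_right_weight (hf : L.IsNPFrame N e κ)
    (hL : L.IsNilradicalExtension N) (ht : L.IsDiagonalizedBy e μ t) (a : NPIndex n m) :
    ∃ χ : L.leftAnnihilator t →ₗ[ℂ] ℂ, ∀ u : L.leftAnnihilator t, L.bracket (e a) u = χ u • e a := by
  refine LinearMap.exists_eq_smul_of_forall
    (L.bracket (e a) ∘ₗ (L.leftAnnihilator t).subtype) (hf.indep.ne_zero a) fun u => ?_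
  refine exists_eq_smul_of_eigenvector (L.rmul t) hf.indep μ ht.injective ht.bracket_eq
    (hf.span_eq.symm ▸ hL.bracket_mem_nilradical _ _) ?_
  have h := hL.leibniz.bracket_bracket_of_right_even (e a) u ht.mem_part
  rw [mem_leftAnnihilator.1 u.2, map_zero, ht.bracket_eq, map_smul, LinearMap.smul_apply] at h
  exact sub_eq_zero.1 h.symm

theorem IsNPFrame.exists_left_weight (hf : L.IsNPFrame N e κ)
    (hL : L.IsNilradicalExtension N) (ht : L.IsDiagonalizedBy e μ t) (a : NPIndex n m) :
    ∃ c : L.leftAnnihilator t →ₗ[ℂ] ℂ, ∀ u : L.leftAnnihilator t, L.bracket u (e a) = c u • e a := by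
  refine LinearMap.exists_eq_smul_of_forall
    (L.rmul (e a) ∘ₗ (L.leftAnnihilator t).subtype) (hf.indep.ne_zero a) fun u => ?_
  refine exists_eq_smul_of_eigenvector (L.rmul t) hf.indep μ ht.injective ht.bracket_eq
    (hf.span_eq.symm ▸ hL.bracket_mem_nilradical _ _) ?_
  have h := hL.leibniz.bracket_bracket_of_right_even u (e a) ht.mem_part
  rw [mem_leftAnnihilator.1 u.2, map_zero, LinearMap.zero_apply, sub_zero, ht.bracket_eq,
    map_smul] at h
  exact h.symm

/-- `χ a u` and `c a u` are the eigenvalues of the right and the left multiplication by `u` at the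
frame vector `e a`. -/
structure IsWeightSystem (L : ComplexSuperalgebra V) (e : NPIndex n m → V) (T : Submodule ℂ V)
    (χ c : NPIndex n m → (T →ₗ[ℂ] ℂ)) : Prop where
  right : ∀ a (u : T), L.bracket (e a) u = χ a u • e a
  left : ∀ a (u : T), L.bracket u (e a) = c a u • e a

variable {T : Submodule ℂ V} {χ c : NPIndex n m → (T →ₗ[ℂ] ℂ)}

theorem IsWeightSystem.right_succ (hw : L.IsWeightSystem e T χ c) (hf : L.IsNPFrame N e κ)
    (hL : L.IsNilradicalExtension N) (hT : T ≤ L.part 0) {a b : NPIndex n m}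
    (hab : L.bracket (e a) (e .x1) = e b) (u : T) : χ b u = χ a u + χ .x1 u := by
  have h := hL.leibniz.bracket_bracket_of_right_even (e a) (e .x1) (hT u.2)
  rw [hw.right, hw.right, hab, hw.right, map_smul, map_smul, LinearMap.smul_apply, hab,
    eq_sub_iff_add_eq, ← add_smul] at h
  rw [add_comm]
  exact (smul_left_injective ℂ (hf.indep.ne_zero b) h).symm

/-- Unlike the right weights, which grow by the weight of x₁ at each step, the left weights stay
constant along a block. -/
theorem IsWeightSystem.left_succ (hw : L.IsWeightSystem e T χ c) (hf : L.IsNPFrame N e κ)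
    (hL : L.IsNilradicalExtension N) {a b : NPIndex n m}
    (hab : L.bracket (e a) (e .x1) = e b) (ha : L.bracket (e .x1) (e a) = 0) (u : T) :
    c b u = c a u := by
  have h := hL.leibniz.bracket_bracket_of_right_even (u : V) (e a) hf.x1_mem_part
  rw [hw.left, hw.left, hab, hw.left, map_smul, map_smul, LinearMap.smul_apply,
    LinearMap.smul_apply, hab, ha, smul_zero, sub_zero] at h
  exact smul_left_injective ℂ (hf.indep.ne_zero b) h

/-- By the Leibniz identity [x,[x₁,u]] = −[x,[u,x₁]]; both sides are multiples of [x,x₁], and x can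
be chosen with [x,x₁] ≠ 0. -/
theorem IsWeightSystem.left_x1 (hw : L.IsWeightSystem e T χ c) (hf : L.IsNPFrame N e κ)
    (hk : 1 ≤ k) (hn : ∀ j, 2 ≤ n j) (hL : L.IsNilradicalExtension N) (hT : T ≤ L.part 0)
    (u : T) : c .x1 u = -χ .x1 u := by
  obtain ⟨x, -, -, hne⟩ := hf.exists_bracket_ne_zero hk hn
  have h1 := hL.leibniz.bracket_bracket_of_right_even x (e .x1) (hT u.2)
  have h2 := hL.leibniz.bracket_bracket_of_right_even x u hf.x1_mem_part
  rw [hw.right, map_smul] at h1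
  rw [hw.left, map_smul, ← neg_sub, ← h1, ← neg_smul] at h2
  exact smul_left_injective ℂ hne h2

/-- Expanding [u,[v,e_d]] shows that a nonzero left weight at d equals minus the right weight. At a
vector and its successor the left weights agree while the right ones differ by the nonzero weight of
x₁, a contradiction. -/
theorem IsWeightSystem.left_eq_zero (hw : L.IsWeightSystem e T χ c) (hf : L.IsNPFrame N e κ)
    (hL : L.IsNilradicalExtension N) (hT : T ≤ L.part 0)
    (hTT : ∀ u ∈ T, ∀ v ∈ T, L.bracket u v = 0) (h1 : ∃ v, χ .x1 v ≠ 0) {a b : NPIndex n m}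
    (hab : L.bracket (e a) (e .x1) = e b) (ha : L.bracket (e .x1) (e a) = 0) : c a = 0 := by
  have key : ∀ (d : NPIndex n m) (u v : T), c d u ≠ 0 → c d v = -χ d v := by
    intro d u v hu
    have h := hL.leibniz.bracket_bracket_of_left_even (u : V) (e d) (hT v.2)
    rw [hTT u u.2 v v.2, map_zero, LinearMap.zero_apply, zero_sub, hw.left, hw.left, map_smul,
      map_smul, LinearMap.smul_apply, hw.left, hw.right, smul_smul, smul_smul, ← neg_smul] at h
    have h' := smul_left_injective ℂ (hf.indep.ne_zero d) h
    exact mul_left_cancel₀ hu (by linear_combination h')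
  ext u
  by_contra hu
  obtain ⟨v, hv⟩ := h1
  have e1 := key a u v hu
  have e2 := key b u v (by rwa [hw.left_succ hf hL hab ha])
  rw [hw.left_succ hf hL hab ha, e1, hw.right_succ hf hL hT hab] at e2
  exact hv (by linear_combination e2)

end ComplexSuperalgebra

/-! ### Index sets of the two bases -/

namespace SNPIndex

variable {k p : ℕ} {n : Fin k → ℕ} {m : Fin p → ℕ}

/-- The index of a basis vector of `NP n m` in the basis of `SNP n m`. -/
def ofNP : NPIndex n m → SNPIndex n m
  | .x1 => .x1
  | .x j i => .x j i
  | .y j i => .y j i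

/-- The index of a basis vector of the torus of `SNP n m`. -/
def ofTorus : Unit ⊕ (Fin k ⊕ Fin p) → SNPIndex n m
  | .inl _ => .t1
  | .inr (.inl j) => .t j
  | .inr (.inr j) => .t' j

/-- The basis of `SNP n m` is the union of the basis of `NP n m` and a basis of a torus. -/
def sumEquiv : NPIndex n m ⊕ (Unit ⊕ (Fin k ⊕ Fin p)) ≃ SNPIndex n m where
  toFun := Sum.elim ofNP ofTorus
  invFun
    | .x1 => .inl .x1
    | .x j i => .inl (.x j i)
    | .y j i => .inl (.y j i)
    | .t1 => .inr (.inl ())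
    | .t j => .inr (.inr (.inl j))
    | .t' j => .inr (.inr (.inr j))
  left_inv := by rintro ((_ | _ | _) | (_ | (_ | _))) <;> rfl
  right_inv := by rintro (_ | _ | _ | _ | _ | _) <;> rfl

end SNPIndex

namespace NPIndex

variable {k p : ℕ} {n : Fin k → ℕ} {m : Fin p → ℕ}

/-- The basis of `NP n m` consists of `x₁`, the even blocks and the odd blocks. -/
def sumEquiv : Unit ⊕ ((Σ j, Fin (n j)) ⊕ (Σ j, Fin (m j))) ≃ NPIndex n m where
  toFun
    | .inl _ => .x1
    | .inr (.inl s) => .x s.1 s.2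
    | .inr (.inr s) => .y s.1 s.2
  invFun
    | .x1 => .inl ()
    | .x j i => .inr (.inl ⟨j, i⟩)
    | .y j i => .inr (.inr ⟨j, i⟩)
  left_inv := by rintro (_ | (_ | _)) <;> rfl
  right_inv := by rintro (_ | _ | _) <;> rfl

instance : Finite (NPIndex n m) := Finite.of_equiv _ sumEquiv

end NPIndex

namespace SNPIndex

variable {k p : ℕ} {n : Fin k → ℕ} {m : Fin p → ℕ}

instance : Finite (SNPIndex n m) := Finite.of_equiv _ sumEquiv

theorem card_eq : Nat.card (SNPIndex n m) = Nat.card (NPIndex n m) + (1 + (k + p)) := by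
  rw [← Nat.card_congr sumEquiv, Nat.card_sum, Nat.card_sum, Nat.card_sum]
  simp

end SNPIndex

/-! ### Recognizing SNP from the weights -/

namespace ComplexSuperalgebra

/-- Only the grading needs an argument: the component of the preimage of the wrong parity maps into
both parts, hence to 0. -/
theorem Isomorphic.symm {V : Type u} [AddCommGroup V] [Module ℂ V] {W : Type v} [AddCommGroup W]
    [Module ℂ W] {A : ComplexSuperalgebra V} {B : ComplexSuperalgebra W} (h : A.Isomorphic B) :
    B.Isomorphic A := by
  obtain ⟨f, hf⟩ := h
  refine ⟨f.symm, fun i x hx => ?_, fun x y => f.injective ?_⟩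
  · obtain ⟨a₀, h₀, a₁, h₁, ha⟩ := A.exists_parts (f.symm x)
    have hx' : x = f a₀ + f a₁ := by rw [← map_add, ← ha, f.apply_symm_apply]
    have h₀' : f a₀ ∈ B.part 0 := hf.map_part 0 a₀ h₀
    have h₁' : f a₁ ∈ B.part 1 := hf.map_part 1 a₁ h₁
    have hi : i = 0 ∨ i = 1 := by
      clear hx
      revert i
      decide
    rw [LinearEquiv.coe_coe, ha]
    rcases hi with rfl | rfl
    · have : f a₁ = 0 := B.eq_zero_of_mem_part (by
        rw [← sub_eq_iff_eq_add'.2 hx']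
        exact sub_mem hx h₀') h₁'
      rwa [f.map_eq_zero_iff.1 this, add_zero]
    · have : f a₀ = 0 := B.eq_zero_of_mem_part h₀' (by
        rw [← sub_eq_iff_eq_add.2 hx']
        exact sub_mem hx h₁')
      rwa [f.map_eq_zero_iff.1 this, zero_add]
  · have := hf.map_bracket (f.symm x) (f.symm y)
    simp only [LinearEquiv.coe_coe, f.apply_symm_apply] at this ⊢
    exact this.symm

theorem ofTable_bracket_single {ι : Type u} (deg : ι → ZMod 2) (table : ι → ι → (ι →₀ ℂ))
    (h : ∀ a b, table a b ∈ Finsupp.supported ℂ ℂ {c | deg c = deg a + deg b}) (a b : ι) :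
    (ofTable deg table h).bracket (Finsupp.single a 1) (Finsupp.single b 1) = table a b := by
  have hs : ∀ c : ι, (Finsupp.single c 1 : ι →₀ ℂ) = Finsupp.basisSingleOne c := by simp
  simp only [ofTable, hs, Basis.constr_basis]

variable {V : Type u} [AddCommGroup V] [Module ℂ V]

theorem isHom_ofTable {ι : Type v} {deg : ι → ZMod 2} {table : ι → ι → (ι →₀ ℂ)}
    {h : ∀ a b, table a b ∈ Finsupp.supported ℂ ℂ {c | deg c = deg a + deg b}}
    {L : ComplexSuperalgebra V} {E : ι → V} (hdeg : ∀ a, E a ∈ L.part (deg a))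
    (hE : ∀ a b, L.bracket (E a) (E b) = Finsupp.linearCombination ℂ E (table a b)) :
    (ofTable deg table h).IsHom L (Finsupp.linearCombination ℂ E) where
  map_part i x hx := by
    rw [Finsupp.linearCombination_apply]
    refine Submodule.sum_mem _ fun a ha => Submodule.smul_mem _ _ ?_
    have : deg a = i := hx (by simpa using ha)
    exact this ▸ hdeg a
  map_bracket x y := by
    have : (ofTable deg table h).bracket.compr₂ (Finsupp.linearCombination ℂ E) =
        L.bracket.compl₁₂ (Finsupp.linearCombination ℂ E) (Finsupp.linearCombination ℂ E) := by
      ext a b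
      simp [ofTable_bracket_single, hE]
    exact congr($this x y)

variable {k p : ℕ} {n : Fin k → ℕ} {m : Fin p → ℕ} {L : ComplexSuperalgebra V}
  {N : Submodule ℂ V} {e : NPIndex n m → V} {κ : V →ₗ[ℂ] ℂ}
variable {T : Submodule ℂ V} {χ c : NPIndex n m → (T →ₗ[ℂ] ℂ)}

/-- The weights of the generators `x₁`, `x_{j,0}`, `y_{j,0}`. -/
def generatorWeights (hn : ∀ j, 0 < n j) (hm : ∀ j, 0 < m j)
    (χ : NPIndex n m → (T →ₗ[ℂ] ℂ)) : T →ₗ[ℂ] (Unit ⊕ (Fin k ⊕ Fin p) → ℂ) :=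
  LinearMap.pi (Sum.elim (fun _ => χ .x1)
    (Sum.elim (fun j => χ (.x j ⟨0, hn j⟩)) (fun j => χ (.y j ⟨0, hm j⟩))))

theorem IsWeightSystem.right_x (hw : L.IsWeightSystem e T χ c) (hf : L.IsNPFrame N e κ)
    (hL : L.IsNilradicalExtension N) (hT : T ≤ L.part 0) (u : T) (j) (i : ℕ) (hi : i < n j) :
    χ (.x j ⟨i, hi⟩) u = χ (.x j ⟨0, by omega⟩) u + i * χ .x1 u := by
  induction i with
  | zero => simp
  | succ i ih =>
    have := hw.right_succ hf hL hT (a := .x j ⟨i, by omega⟩) (b := .x j ⟨i + 1, hi⟩)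
      (by rw [hf.bracket_x_x1, dif_pos hi]) u
    rw [this, ih]
    push_cast
    ring

theorem IsWeightSystem.right_y (hw : L.IsWeightSystem e T χ c) (hf : L.IsNPFrame N e κ)
    (hL : L.IsNilradicalExtension N) (hT : T ≤ L.part 0) (u : T) (j) (i : ℕ) (hi : i < m j) :
    χ (.y j ⟨i, hi⟩) u = χ (.y j ⟨0, by omega⟩) u + i * χ .x1 u := by
  induction i with
  | zero => simp
  | succ i ih =>
    have := hw.right_succ hf hL hT (a := .y j ⟨i, by omega⟩) (b := .y j ⟨i + 1, hi⟩)
      (by rw [hf.bracket_y_x1, dif_pos hi]) u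
    rw [this, ih]
    push_cast
    ring

theorem IsWeightSystem.left_x (hw : L.IsWeightSystem e T χ c) (hf : L.IsNPFrame N e κ)
    (hn : ∀ j, 2 ≤ n j) (hL : L.IsNilradicalExtension N) (hT : T ≤ L.part 0)
    (hTT : ∀ u ∈ T, ∀ v ∈ T, L.bracket u v = 0) (h1 : ∃ v, χ .x1 v ≠ 0) (u : T) (j)
    (i : ℕ) (hi : i < n j) : c (.x j ⟨i, hi⟩) u = 0 := by
  induction i with
  | zero =>
    -- Length at least 2 gives the first vector of the block a successor.
    rw [hw.left_eq_zero hf hL hT hTT h1 (b := .x j ⟨1, hn j⟩)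
      (by rw [hf.bracket_x_x1]; exact dif_pos (hn j)) (hf.bracket_x _ _ _), LinearMap.zero_apply]
  | succ i ih =>
    rw [hw.left_succ hf hL (a := .x j ⟨i, by omega⟩) (by rw [hf.bracket_x_x1, dif_pos hi])
      (hf.bracket_x _ _ _), ih]

theorem IsWeightSystem.left_y (hw : L.IsWeightSystem e T χ c) (hf : L.IsNPFrame N e κ)
    (hm : ∀ j, 2 ≤ m j) (hL : L.IsNilradicalExtension N) (hT : T ≤ L.part 0)
    (hTT : ∀ u ∈ T, ∀ v ∈ T, L.bracket u v = 0) (h1 : ∃ v, χ .x1 v ≠ 0) (u : T) (j)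
    (i : ℕ) (hi : i < m j) : c (.y j ⟨i, hi⟩) u = 0 := by
  induction i with
  | zero =>
    rw [hw.left_eq_zero hf hL hT hTT h1 (b := .y j ⟨1, hm j⟩)
      (by rw [hf.bracket_y_x1]; exact dif_pos (hm j)) (hf.bracket_y _ _ _), LinearMap.zero_apply]
  | succ i ih =>
    rw [hw.left_succ hf hL (a := .y j ⟨i, by omega⟩) (by rw [hf.bracket_y_x1, dif_pos hi])
      (hf.bracket_y _ _ _), ih]

/-- The generators determine all right weights, so an element in the kernel annihilates N from the
right; it then lies in N, which meets T trivially. -/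
theorem IsWeightSystem.generatorWeights_injective (hw : L.IsWeightSystem e T χ c)
    (hf : L.IsNPFrame N e κ) (hn : ∀ j, 0 < n j) (hm : ∀ j, 0 < m j)
    (hL : L.IsNilradicalExtension N) (hT : T ≤ L.part 0) (hNT : Disjoint N T) :
    Function.Injective (generatorWeights hn hm χ) := by
  rw [← LinearMap.ker_eq_bot, LinearMap.ker_eq_bot']
  intro u hu
  have hu' : ∀ s, generatorWeights hn hm χ u s = 0 := fun s => congrFun hu s
  have h1 : χ .x1 u = 0 := hu' (.inl ())
  have h0 : ∀ b, χ b u = 0 := by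
    rintro (_ | ⟨j, i⟩ | ⟨j, i⟩)
    · exact h1
    · rw [hw.right_x hf hL hT, h1, mul_zero, add_zero]
      exact hu' (.inr (.inl j))
    · rw [hw.right_y hf hL hT, h1, mul_zero, add_zero]
      exact hu' (.inr (.inr j))
  have huN : (u : V) ∈ N := hf.mem_of_bracket_eq_zero hL (hT u.2) fun b => by
    rw [hw.right, h0, zero_smul]
  exact Subtype.ext (Submodule.disjoint_def.1 hNT u huN u.2)

/-- If a torus complementary to `N` is dual to the generators of `N`, then `L` is isomorphic to
`SNP n m`. -/
theorem IsWeightSystem.isomorphic (hw : L.IsWeightSystem e T χ c) (hf : L.IsNPFrame N e κ)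
    (hk : 1 ≤ k) (hn : ∀ j, 2 ≤ n j) (hm : ∀ j, 2 ≤ m j)
    (hL : L.IsNilradicalExtension N) (hT : T ≤ L.part 0) (hNT : IsCompl N T)
    (hTT : ∀ u ∈ T, ∀ v ∈ T, L.bracket u v = 0)
    (hΘ : Function.Bijective (generatorWeights (fun j => by have := hn j; omega)
      (fun j => by have := hm j; omega) χ)) :
    L.Isomorphic (SNP n m) := by
  classical
  set Θ := generatorWeights (fun j => by have := hn j; omega)
      (fun j => by have := hm j; omega) χ with hΘdef
  -- The basis of T dual to the generator weights; it supplies t₁, the tⱼ and the t′ⱼ.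
  let τ : Basis (Unit ⊕ (Fin k ⊕ Fin p)) ℂ T := Basis.ofEquivFun (LinearEquiv.ofBijective Θ hΘ)
  have hτ : ∀ s r, Θ (τ s) r = if s = r then 1 else 0 := by
    intro s r
    have h1 : LinearEquiv.ofBijective Θ hΘ (τ s) = Pi.single s 1 := by
      simp [τ, Basis.coe_ofEquivFun]
    have h2 := congrFun h1 r
    rw [LinearEquiv.ofBijective_apply] at h2
    rw [h2, Pi.single_apply]
    simp [eq_comm]
  have hx1 : ∀ s, χ .x1 (τ s) = if s = .inl () then 1 else 0 := fun s => hτ s (.inl ())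
  have hx : ∀ s j i, χ (.x j i) (τ s) =
      (if s = .inr (.inl j) then 1 else 0) + i.val * (if s = .inl () then 1 else 0) := by
    intro s j i
    rw [← hx1, ← hτ]
    exact hw.right_x hf hL hT _ j i.val i.isLt
  have hy : ∀ s j i, χ (.y j i) (τ s) =
      (if s = .inr (.inr j) then 1 else 0) + i.val * (if s = .inl () then 1 else 0) := by
    intro s j i
    rw [← hx1, ← hτ]
    exact hw.right_y hf hL hT _ j i.val i.isLt
  have hne : ∃ v, χ .x1 v ≠ 0 := ⟨τ (.inl ()), by rw [hx1]; simp⟩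
  let E₀ : Basis (NPIndex n m ⊕ (Unit ⊕ (Fin k ⊕ Fin p))) ℂ V :=
    (((Basis.span hf.indep).map (LinearEquiv.ofEq _ _ hf.span_eq)).prod τ).map
      (Submodule.prodEquivOfIsCompl N T hNT)
  let E : Basis (SNPIndex n m) ℂ V := E₀.reindex SNPIndex.sumEquiv
  have hEN : ∀ a, E (SNPIndex.ofNP a) = e a := by
    intro a
    rw [show SNPIndex.ofNP a = SNPIndex.sumEquiv (.inl a) from rfl]
    simp [E, E₀, Basis.span_apply]
  have hET : ∀ s, E (SNPIndex.ofTorus s) = τ s := by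
    intro s
    rw [show SNPIndex.ofTorus s = SNPIndex.sumEquiv (.inr s) from rfl]
    simp [E, E₀]
  have Ex1 : E .x1 = e .x1 := hEN .x1
  have Ex : ∀ j i, E (.x j i) = e (.x j i) := fun j i => hEN (.x j i)
  have Ey : ∀ j i, E (.y j i) = e (.y j i) := fun j i => hEN (.y j i)
  have Et1 : E .t1 = τ (.inl ()) := hET (.inl ())
  have Et : ∀ j, E (.t j) = τ (.inr (.inl j)) := fun j => hET (.inr (.inl j))
  have Et' : ∀ j, E (.t' j) = τ (.inr (.inr j)) := fun j => hET (.inr (.inr j))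
  have hττ : ∀ s r, L.bracket (τ s : V) (τ r) = 0 := fun s r => hTT _ (τ s).2 _ (τ r).2
  have hc1 := hw.left_x1 hf hk hn hL hT
  have hcx : ∀ u j i, c (.x j i) u = 0 := fun u j i =>
    hw.left_x hf hn hL hT hTT hne u j i.val i.isLt
  have hcy : ∀ u j i, c (.y j i) u = 0 := fun u j i =>
    hw.left_y hf hm hL hT hTT hne u j i.val i.isLt
  have hdeg : ∀ a, E a ∈ L.part a.deg := by
    rintro (_ | ⟨j, i⟩ | _ | j | j | ⟨j, i⟩)
    · exact Ex1 ▸ hf.x1_mem_part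
    · exact Ex j i ▸ hf.x_mem_part j i
    · exact Et1 ▸ hT (τ _).2
    · exact Et j ▸ hT (τ _).2
    · exact Et' j ▸ hT (τ _).2
    · exact Ey j i ▸ hf.y_mem_part j i
  have hprod : ∀ a b, L.bracket (E a) (E b) =
      Finsupp.linearCombination ℂ E (SNPIndex.table a b) := by
    rintro (_ | ⟨j, i⟩ | _ | j | j | ⟨j, i⟩) (_ | ⟨j', i'⟩ | _ | j' | j' | ⟨j', i'⟩) <;>
      simp only [SNPIndex.table, Ex1, Ex, Ey, Et1, Et, Et', hw.left, hw.right, hττ, hf.bracket_x,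
        hf.bracket_y, hf.bracket_x_x1, hf.bracket_y_x1, hf.bracket_x1_x1, hc1, hcx, hcy, hx1,
        hx, hy, map_zero, zero_smul, Finsupp.linearCombination_single]
    all_goals
      clear * - Ex Ey
      try simp only [reduceCtorEq, Sum.inl.injEq, Sum.inr.injEq, if_true, if_false, mul_one,
        mul_zero, add_zero, zero_add, one_smul, neg_zero, zero_smul]
      try (split_ifs <;> simp [Ex, Ey])
  have hhom : (SNP n m).IsHom L (Finsupp.linearCombination ℂ E) := isHom_ofTable hdeg hprod
  refine Isomorphic.symm ⟨E.repr.symm, ?_⟩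
  rwa [show (E.repr.symm : (SNPIndex n m →₀ ℂ) →ₗ[ℂ] V) = Finsupp.linearCombination ℂ E from
    LinearMap.ext fun x => E.repr_symm_apply x]

end ComplexSuperalgebra

/-! ### SNP is a solvable Leibniz superalgebra with nilpotent square -/

namespace ComplexSuperalgebra

section Nilpotent

variable {V : Type u} [AddCommGroup V] [Module ℂ V] {L : ComplexSuperalgebra V}

theorem bracketSpan_mono {A A' B B' : Submodule ℂ V} (hA : A ≤ A') (hB : B ≤ B') :
    L.bracketSpan A B ≤ L.bracketSpan A' B' :=
  Submodule.map₂_le_map₂ hA hB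

theorem centralSeq_mono {S S' : Submodule ℂ V} (h : S ≤ S') (r : ℕ) :
    L.centralSeq S r ≤ L.centralSeq S' r := by
  induction r with
  | zero => exact h
  | succ r ih => exact bracketSpan_mono ih h

theorem IsNilpotentSub.mono {S S' : Submodule ℂ V} (h : S ≤ S') (hS : L.IsNilpotentSub S') :
    L.IsNilpotentSub S := by
  obtain ⟨r, hr⟩ := hS
  exact ⟨r, le_bot_iff.1 (hr ▸ centralSeq_mono h r)⟩

theorem derivedSeq_succ_le_square (r : ℕ) : L.derivedSeq (r + 1) ≤ L.square :=
  bracketSpan_mono le_top le_top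

/-- From its second term on, the derived sequence is dominated by the central sequence of the
square. -/
theorem isSolvable_of_isNilpotentSub_square (h : L.IsNilpotentSub L.square) : L.IsSolvable := by
  have key : ∀ r, L.derivedSeq (r + 1) ≤ L.centralSeq L.square r := by
    intro r
    induction r with
    | zero => exact derivedSeq_succ_le_square 0
    | succ r ih => exact bracketSpan_mono ih (derivedSeq_succ_le_square r)
  obtain ⟨r, hr⟩ := h
  exact ⟨r + 1, le_bot_iff.1 (hr ▸ key r)⟩

end Nilpotent

variable {k p : ℕ} {n : Fin k → ℕ} {m : Fin p → ℕ}
variable {V : Type u} [AddCommGroup V] [Module ℂ V]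

/-- `E` is a basis of `M` with the parities and products of the standard basis of `SNP n m`. -/
structure IsSNPBasis (M : ComplexSuperalgebra V) (E : Basis (SNPIndex n m) ℂ V) : Prop where
  mem_part : ∀ a, E a ∈ M.part a.deg
  bracket_eq : ∀ a b, M.bracket (E a) (E b) = Finsupp.linearCombination ℂ E (a.table b)
  bracket_odd : ∀ x, ∀ y ∈ M.part 1, M.bracket x y = 0

variable {M : ComplexSuperalgebra V} {E : Basis (SNPIndex n m) ℂ V}

theorem IsSNPBasis.bracket_x (h : M.IsSNPBasis E) (v : V) (j i) :
    M.bracket v (E (.x j i)) = 0 := by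
  have : M.rmul (E (.x j i)) = 0 := E.ext fun a => by
    rw [rmul_apply, h.bracket_eq]
    cases a <;> simp [SNPIndex.table]
  exact congr($this v)

theorem IsSNPBasis.bracket_y (h : M.IsSNPBasis E) (v : V) (j i) :
    M.bracket v (E (.y j i)) = 0 :=
  h.bracket_odd v _ (h.mem_part (.y j i))

/-- The identity holds without sign for all vectors. It is checked on basis triples; the only basis
vectors acting nontrivially from the right are x₁ and the torus elements. -/
theorem IsSNPBasis.bracket_bracket (h : M.IsSNPBasis E) (x y z : V) :
    M.bracket x (M.bracket y z) =
      M.bracket (M.bracket x y) z - M.bracket (M.bracket x z) y := by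
  have key : ∀ a b c, M.bracket (E a) (M.bracket (E b) (E c)) =
      M.bracket (M.bracket (E a) (E b)) (E c) - M.bracket (M.bracket (E a) (E c)) (E b) := by
    intro a b c
    rcases b with _ | ⟨j', i'⟩ | _ | j' | j' | ⟨j', i'⟩ <;>
    rcases c with _ | ⟨l, i''⟩ | _ | l | l | ⟨l, i''⟩ <;>
      try simp only [h.bracket_x, h.bracket_y, map_zero, LinearMap.zero_apply, sub_zero]
    all_goals
      simp only [h.bracket_eq, SNPIndex.table, map_zero, Finsupp.linearCombination_single,
        map_smul, smul_zero] <;>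
      (try split_ifs) <;>
      (try simp only [map_zero, Finsupp.linearCombination_single, map_smul, h.bracket_x,
        h.bracket_y, smul_zero]) <;>
      rcases a with _ | ⟨j, i⟩ | _ | j | j | ⟨j, i⟩ <;>
      simp only [h.bracket_eq, SNPIndex.table, map_zero, Finsupp.linearCombination_single,
        map_smul, LinearMap.zero_apply, LinearMap.smul_apply, smul_zero, sub_self] <;>
      (try split_ifs) <;>
      (try simp only [h.bracket_eq, SNPIndex.table, map_zero, Finsupp.linearCombination_single,
        LinearMap.zero_apply, smul_zero, sub_self, one_smul]) <;>
      (try split_ifs) <;>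
      simp_all <;>
      module
  induction E.mem_span x using Submodule.span_induction with
  | zero => simp
  | add v w _ _ h1 h2 => simp only [map_add, LinearMap.add_apply, h1, h2]; abel
  | smul c v _ h => simp only [map_smul, LinearMap.smul_apply, h, smul_sub]
  | mem x hx =>
    obtain ⟨a, rfl⟩ := hx
    induction E.mem_span y using Submodule.span_induction with
    | zero => simp
    | add v w _ _ h1 h2 => simp only [map_add, LinearMap.add_apply, h1, h2]; abel
    | smul c v _ h => simp only [map_smul, LinearMap.smul_apply, h, smul_sub]
    | mem y hy =>
      obtain ⟨b, rfl⟩ := hy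
      induction E.mem_span z using Submodule.span_induction with
      | zero => simp
      | add v w _ _ h1 h2 => simp only [map_add, LinearMap.add_apply, h1, h2]; abel
      | smul c v _ h => simp only [map_smul, LinearMap.smul_apply, h, smul_sub]
      | mem z hz =>
        obtain ⟨c, rfl⟩ := hz
        exact key a b c

theorem IsSNPBasis.isLeibniz (h : M.IsSNPBasis E) : M.IsLeibniz := by
  intro i j x y hy z hz
  rw [h.bracket_bracket]
  have hi : i = 0 ∨ i = 1 := by
    clear hy
    revert i
    decide
  rcases hi with rfl | rfl
  · simp
  -- The sign can matter only for odd y, and then the signed term vanishes.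
  · rw [h.bracket_odd (M.bracket x z) y hy, smul_zero]

/-- The span of the basis vectors of `NP n m`. -/
def npSpan (E : Basis (SNPIndex n m) ℂ V) : Submodule ℂ V :=
  Submodule.span ℂ (Set.range fun a : NPIndex n m => E (SNPIndex.ofNP a))

theorem mem_npSpan (E : Basis (SNPIndex n m) ℂ V) (a : NPIndex n m) :
    E (SNPIndex.ofNP a) ∈ npSpan E := Submodule.subset_span ⟨a, rfl⟩

theorem mem_npSpan_of_repr_eq_zero {v : V} (ht1 : E.repr v .t1 = 0) (ht : ∀ j, E.repr v (.t j) = 0)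
    (ht' : ∀ j, E.repr v (.t' j) = 0) : v ∈ npSpan E := by
  rw [← E.linearCombination_repr v, Finsupp.linearCombination_apply, Finsupp.sum]
  refine Submodule.sum_mem _ fun a ha => ?_
  rw [Finsupp.mem_support_iff] at ha
  refine Submodule.smul_mem _ _ ?_
  rcases a with _ | ⟨j, i⟩ | _ | j | j | ⟨j, i⟩
  · exact mem_npSpan E .x1
  · exact mem_npSpan E (.x j i)
  · exact absurd ht1 ha
  · exact absurd (ht j) ha
  · exact absurd (ht' j) ha
  · exact mem_npSpan E (.y j i)

theorem IsSNPBasis.bracket_mem_npSpan (h : M.IsSNPBasis E) (x y : V) :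
    M.bracket x y ∈ npSpan E := by
  have key : ∀ a b, M.bracket (E a) (E b) ∈ npSpan E := by
    intro a b
    rw [h.bracket_eq]
    have hx1 : E .x1 ∈ npSpan E := mem_npSpan E .x1
    have hx : ∀ j i, E (.x j i) ∈ npSpan E := fun j i => mem_npSpan E (.x j i)
    have hy : ∀ j i, E (.y j i) ∈ npSpan E := fun j i => mem_npSpan E (.y j i)
    rcases a with _ | ⟨j, i⟩ | _ | j | j | ⟨j, i⟩ <;>
      rcases b with _ | ⟨j', i'⟩ | _ | j' | j' | ⟨j', i'⟩ <;>
      simp only [SNPIndex.table, map_zero, Submodule.zero_mem] <;>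
      (try split_ifs) <;>
      simp only [map_zero, Submodule.zero_mem, Finsupp.linearCombination_single] <;>
      first
      | exact Submodule.smul_mem _ _ hx1
      | exact Submodule.smul_mem _ _ (hx _ _)
      | exact Submodule.smul_mem _ _ (hy _ _)
  have hle : M.bracketSpan (Submodule.span ℂ (Set.range E)) (Submodule.span ℂ (Set.range E)) ≤
      npSpan E := by
    rw [bracketSpan, Submodule.map₂_span_span, Submodule.span_le]
    rintro _ ⟨_, ⟨a, rfl⟩, _, ⟨b, rfl⟩, rfl⟩
    exact key a b
  exact hle (Submodule.apply_mem_map₂ _ (E.mem_span x) (E.mem_span y))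

theorem IsSNPBasis.isIdeal_npSpan (h : M.IsSNPBasis E) : M.IsIdeal (npSpan E) where
  graded := by
    refine le_antisymm (Submodule.span_le.2 ?_) (sup_le inf_le_left inf_le_left)
    rintro _ ⟨a, rfl⟩
    have hp := h.mem_part (SNPIndex.ofNP a)
    cases a with
    | x1 => exact Submodule.mem_sup_left ⟨mem_npSpan E _, hp⟩
    | x j i => exact Submodule.mem_sup_left ⟨mem_npSpan E _, hp⟩
    | y j i => exact Submodule.mem_sup_right ⟨mem_npSpan E _, hp⟩
  bracket_left _ _ _ := h.bracket_mem_npSpan _ _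
  bracket_right _ _ _ := h.bracket_mem_npSpan _ _

/-- The position of a basis vector in its block. -/
def _root_.NPIndex.depth : NPIndex n m → ℕ
  | .x1 => 0
  | .x _ i => i.val
  | .y _ i => i.val

theorem IsSNPBasis.isNilpotentSub_npSpan (h : M.IsSNPBasis E) :
    M.IsNilpotentSub (npSpan E) := by
  -- Filtration by position in the block: the nonzero products inside N move a block vector one
  -- position further.
  let F : ℕ → Submodule ℂ V := fun r =>
    Submodule.span ℂ ((fun a : NPIndex n m => E (SNPIndex.ofNP a)) '' {a | r ≤ a.depth})
  have hF : ∀ r a, r ≤ NPIndex.depth a → E (SNPIndex.ofNP a) ∈ F r :=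
    fun r a ha => Submodule.subset_span ⟨a, ha, rfl⟩
  have hstep : ∀ r, M.bracketSpan (F r) (npSpan E) ≤ F (r + 1) := by
    intro r
    rw [npSpan, bracketSpan, Submodule.map₂_span_span, Submodule.span_le]
    rintro _ ⟨_, ⟨a, ha, rfl⟩, _, ⟨b, rfl⟩, rfl⟩
    have ha' : r ≤ a.depth := ha
    simp only [h.bracket_eq, SetLike.mem_coe]
    rcases a with _ | ⟨j, i⟩ | ⟨j, i⟩ <;> rcases b with _ | ⟨j', i'⟩ | ⟨j', i'⟩ <;>
      simp only [SNPIndex.ofNP, SNPIndex.table, map_zero, Submodule.zero_mem] <;>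
      split_ifs with hi <;>
      simp only [map_zero, Submodule.zero_mem, Finsupp.linearCombination_single, one_smul]
    · exact hF (r + 1) (.x j ⟨i.val + 1, hi⟩) (Nat.succ_le_succ ha')
    · exact hF (r + 1) (.y j ⟨i.val + 1, hi⟩) (Nat.succ_le_succ ha')
  have hC : ∀ r, M.centralSeq (npSpan E) r ≤ F r := by
    intro r
    induction r with
    | zero =>
      refine Submodule.span_mono ?_
      rintro _ ⟨a, rfl⟩
      exact ⟨a, Nat.zero_le _, rfl⟩
    | succ r ih => exact (bracketSpan_mono ih le_rfl).trans (hstep r)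
  obtain ⟨B, hB⟩ := Finite.exists_le (NPIndex.depth : NPIndex n m → ℕ)
  refine ⟨B + 1, le_bot_iff.1 ((hC (B + 1)).trans (Submodule.span_le.2 ?_))⟩
  rintro _ ⟨a, ha, rfl⟩
  exact absurd (hB a) (not_le.2 ha)

/-- The first vector of a block is never reached by x₁, and t₁ multiplies it by its position 0, so
only `t j` contributes. The torus coordinates of `v` thus become eigenvalue-like factors. -/
theorem IsSNPBasis.repr_bracket_x (h : M.IsSNPBasis E) (w v : V) (j) (h0 : 0 < n j) :
    E.repr (M.bracket w v) (.x j ⟨0, h0⟩) = E.repr w (.x j ⟨0, h0⟩) * E.repr v (.t j) := by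
  have : M.bracket.compr₂ (E.coord (.x j ⟨0, h0⟩)) =
      (LinearMap.mul ℂ ℂ).compl₁₂ (E.coord (.x j ⟨0, h0⟩)) (E.coord (.t j)) := by
    refine LinearMap.ext_basis E E fun a b => ?_
    simp only [LinearMap.compr₂_apply, h.bracket_eq, Basis.coord_apply, E.repr_linearCombination,
      LinearMap.compl₁₂_apply, LinearMap.mul_apply', E.repr_self]
    have hne : ∀ j' i' hi', SNPIndex.x j ⟨0, h0⟩ ≠ (.x j' ⟨i' + 1, hi'⟩ : SNPIndex n m) := by
      rintro j' i' hi' ⟨⟩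
    by_cases ha : a = .x j ⟨0, h0⟩
    · subst ha
      rcases b with _ | ⟨j', i'⟩ | _ | j' | j' | ⟨j', i'⟩ <;>
        simp only [SNPIndex.table] <;>
        (try split_ifs) <;> simp_all
    · rcases a with _ | ⟨j', i'⟩ | _ | j' | j' | ⟨j', i'⟩ <;>
        rcases b with _ | ⟨l, i''⟩ | _ | l | l | ⟨l, i''⟩ <;>
        simp only [SNPIndex.table] <;>
        (try split_ifs) <;> simp_all [Finsupp.single_eq_of_ne]
  exact congr($this w v)

theorem IsSNPBasis.repr_bracket_y (h : M.IsSNPBasis E) (w v : V) (j) (h0 : 0 < m j) :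
    E.repr (M.bracket w v) (.y j ⟨0, h0⟩) = E.repr w (.y j ⟨0, h0⟩) * E.repr v (.t' j) := by
  have : M.bracket.compr₂ (E.coord (.y j ⟨0, h0⟩)) =
      (LinearMap.mul ℂ ℂ).compl₁₂ (E.coord (.y j ⟨0, h0⟩)) (E.coord (.t' j)) := by
    refine LinearMap.ext_basis E E fun a b => ?_
    simp only [LinearMap.compr₂_apply, h.bracket_eq, Basis.coord_apply, E.repr_linearCombination,
      LinearMap.compl₁₂_apply, LinearMap.mul_apply', E.repr_self]
    have hne : ∀ j' i' hi', SNPIndex.y j ⟨0, h0⟩ ≠ (.y j' ⟨i' + 1, hi'⟩ : SNPIndex n m) := by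
      rintro j' i' hi' ⟨⟩
    by_cases ha : a = .y j ⟨0, h0⟩
    · subst ha
      rcases b with _ | ⟨j', i'⟩ | _ | j' | j' | ⟨j', i'⟩ <;>
        simp only [SNPIndex.table] <;>
        (try split_ifs) <;> simp_all
    · rcases a with _ | ⟨j', i'⟩ | _ | j' | j' | ⟨j', i'⟩ <;>
        rcases b with _ | ⟨l, i''⟩ | _ | l | l | ⟨l, i''⟩ <;>
        simp only [SNPIndex.table] <;>
        (try split_ifs) <;> simp_all [Finsupp.single_eq_of_ne]
  exact congr($this w v)

/-- The coefficient of x₁ arises only from [x₁,t₁] = x₁ and [t₁,x₁] = −x₁. -/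
theorem IsSNPBasis.repr_bracket_x1 (h : M.IsSNPBasis E) (w v : V) :
    E.repr (M.bracket w v) .x1 = E.repr w .x1 * E.repr v .t1 - E.repr w .t1 * E.repr v .x1 := by
  have : M.bracket.compr₂ (E.coord .x1) =
      (LinearMap.mul ℂ ℂ).compl₁₂ (E.coord .x1) (E.coord .t1) -
        (LinearMap.mul ℂ ℂ).compl₁₂ (E.coord .t1) (E.coord .x1) := by
    refine LinearMap.ext_basis E E fun a b => ?_
    simp only [LinearMap.compr₂_apply, h.bracket_eq, Basis.coord_apply, E.repr_linearCombination,
      LinearMap.compl₁₂_apply, LinearMap.mul_apply', E.repr_self, LinearMap.sub_apply]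
    by_cases ha : a = .x1
    · subst ha
      rcases b with _ | ⟨j', i'⟩ | _ | j' | j' | ⟨j', i'⟩ <;>
        simp only [SNPIndex.table] <;> simp_all
    · rcases a with _ | ⟨j', i'⟩ | _ | j' | j' | ⟨j', i'⟩ <;>
        rcases b with _ | ⟨l, i''⟩ | _ | l | l | ⟨l, i''⟩ <;>
        simp only [SNPIndex.table] <;>
        (try split_ifs) <;> simp_all [Finsupp.single_eq_of_ne]
  exact congr($this w v)

end ComplexSuperalgebra

/-! ### The nilradical of SNP and the final dimension count -/

namespace ComplexSuperalgebra

variable {k p : ℕ} {n : Fin k → ℕ} {m : Fin p → ℕ}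
variable {V : Type u} [AddCommGroup V] [Module ℂ V]
variable {M : ComplexSuperalgebra V} {E : Basis (SNPIndex n m) ℂ V}

/-- One multiplication by `v` brings an arbitrary `w` into the ideal, whence the exponent `r + 1`.
-/
theorem rmul_pow_mem_centralSeq {I : Submodule ℂ V} (hI : M.IsIdeal I) {v : V} (hv : v ∈ I)
    (w : V) (r : ℕ) : (M.rmul v ^ (r + 1)) w ∈ M.centralSeq I r := by
  induction r with
  | zero =>
    rw [zero_add, pow_one]
    exact hI.bracket_right v hv w
  | succ r ih =>
    rw [pow_succ', Module.End.mul_apply]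
    exact Submodule.apply_mem_map₂ _ ih hv

/-- An element of a nilpotent ideal has nilpotent right multiplication. Following the coefficient of
each generator shows that powers of the torus coordinates of the element vanish, so it has no torus
part. -/
theorem IsSNPBasis.isNilradical_npSpan (h : M.IsSNPBasis E) (hn : ∀ j, 0 < n j)
    (hm : ∀ j, 0 < m j) : M.IsNilradical (npSpan E) where
  isIdeal := h.isIdeal_npSpan
  nilpotent := h.isNilpotentSub_npSpan
  largest I hI hnil v hv := by
    obtain ⟨r, hr⟩ := hnil
    have hzero : ∀ w, (M.rmul v ^ (r + 1)) w = 0 := fun w => by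
      have := rmul_pow_mem_centralSeq hI hv w r
      rwa [hr] at this
    have hx : ∀ (j) (s : ℕ), E.repr ((M.rmul v ^ s) (E (.x j ⟨0, hn j⟩))) (.x j ⟨0, hn j⟩) =
        E.repr v (.t j) ^ s := by
      intro j s
      induction s with
      | zero => simp
      | succ s ih =>
        rw [pow_succ', Module.End.mul_apply, rmul_apply, h.repr_bracket_x, ih, pow_succ]
    have hy : ∀ (j) (s : ℕ), E.repr ((M.rmul v ^ s) (E (.y j ⟨0, hm j⟩))) (.y j ⟨0, hm j⟩) =
        E.repr v (.t' j) ^ s := by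
      intro j s
      induction s with
      | zero => simp
      | succ s ih =>
        rw [pow_succ', Module.End.mul_apply, rmul_apply, h.repr_bracket_y, ih, pow_succ]
    -- Removes the second term of the formula for the x₁ coefficient, leaving a pure power.
    have ht : ∀ s : ℕ, E.repr ((M.rmul v ^ s) (E .x1)) .t1 = 0 := by
      intro s
      have hN : ∀ w ∈ npSpan E, E.repr w .t1 = 0 := by
        intro w hw
        rw [← E.coord_apply, ← LinearMap.mem_ker]
        refine (Submodule.span_le (p := LinearMap.ker (E.coord .t1))).2 ?_ hw
        rintro _ ⟨a, rfl⟩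
        cases a <;> simp [SNPIndex.ofNP]
      cases s with
      | zero => simp
      | succ s =>
        rw [pow_succ', Module.End.mul_apply]
        exact hN _ (h.bracket_mem_npSpan _ _)
    have hx1 : ∀ s : ℕ, E.repr ((M.rmul v ^ s) (E .x1)) .x1 = E.repr v .t1 ^ s := by
      intro s
      induction s with
      | zero => simp
      | succ s ih =>
        rw [pow_succ', Module.End.mul_apply, rmul_apply, h.repr_bracket_x1, ih, ht, pow_succ,
          zero_mul, sub_zero]
    refine mem_npSpan_of_repr_eq_zero ?_ (fun j => ?_) fun j => ?_
    · refine eq_zero_of_pow_eq_zero (n := r + 1) ?_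
      rw [← hx1, hzero]
      simp
    · refine eq_zero_of_pow_eq_zero (n := r + 1) ?_
      rw [← hx, hzero]
      simp
    · refine eq_zero_of_pow_eq_zero (n := r + 1) ?_
      rw [← hy, hzero]
      simp

theorem IsSNPBasis.isomorphicToSub (h : M.IsSNPBasis E) :
    (NP n m).IsomorphicToSub M (npSpan E) := by
  refine ⟨Finsupp.linearCombination ℂ fun a => E (SNPIndex.ofNP a), ?_, ?_, ?_⟩
  · refine isHom_ofTable (fun a => ?_) fun a b => ?_
    · have := h.mem_part (SNPIndex.ofNP a)
      cases a <;> exact this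
    · rw [h.bracket_eq]
      rcases a with _ | ⟨j, i⟩ | ⟨j, i⟩ <;> rcases b with _ | ⟨j', i'⟩ | ⟨j', i'⟩ <;>
        simp only [SNPIndex.ofNP, SNPIndex.table, NPIndex.table, map_zero] <;>
        split_ifs <;> simp
  · exact E.linearIndependent.comp _ fun a b hab => by
      cases a <;> cases b <;> cases hab <;> rfl
  · exact Finsupp.range_linearCombination _

theorem IsSNPBasis.isSolvableWithNilradical (h : M.IsSNPBasis E) (hn : ∀ j, 0 < n j)
    (hm : ∀ j, 0 < m j) : M.IsSolvableWithNilradical (NP n m) := by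
  have hsq : M.square ≤ npSpan E := Submodule.map₂_le.2 fun x _ y _ => h.bracket_mem_npSpan x y
  have hnil : M.IsNilpotentSub M.square := h.isNilpotentSub_npSpan.mono hsq
  exact ⟨Module.Finite.of_basis E, h.isLeibniz, isSolvable_of_isNilpotentSub_square hnil, hnil,
    npSpan E, h.isNilradical_npSpan hn hm, h.isomorphicToSub⟩

/-- A copy of `SNP n m` in an arbitrary universe. -/
theorem exists_isSNPBasis (n : Fin k → ℕ) (m : Fin p → ℕ) :
    ∃ (M : ComplexSuperalgebra (ULift.{u} (SNPIndex n m) →₀ ℂ))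
      (E : Basis (SNPIndex n m) ℂ (ULift.{u} (SNPIndex n m) →₀ ℂ)), M.IsSNPBasis E := by
  -- Maximality compares only algebras in the universe of V, hence the lifted index type.
  let table : ULift.{u} (SNPIndex n m) → ULift.{u} (SNPIndex n m) →
      (ULift.{u} (SNPIndex n m) →₀ ℂ) := fun a b => (a.down.table b.down).mapDomain ULift.up
  let deg : ULift.{u} (SNPIndex n m) → ZMod 2 := fun a => a.down.deg
  have htable : ∀ a b, table a b ∈ Finsupp.supported ℂ ℂ {c | deg c = deg a + deg b} := by
    intro a b
    rw [Finsupp.mem_supported]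
    classical
    refine (Finset.coe_subset.2 Finsupp.mapDomain_support).trans ?_
    rw [Finset.coe_image, Set.image_subset_iff]
    exact SNPIndex.table_mem a.down b.down
  let M := ofTable deg table htable
  let E : Basis (SNPIndex n m) ℂ (ULift.{u} (SNPIndex n m) →₀ ℂ) :=
    Finsupp.basisSingleOne.reindex Equiv.ulift
  have hE : ∀ a, E a = Finsupp.single (ULift.up a) 1 := fun a => by
    simp only [E, Basis.reindex_apply, Finsupp.coe_basisSingleOne]
    rfl
  have hbr : ∀ a b, M.bracket (E a) (E b) = Finsupp.linearCombination ℂ E (a.table b) := by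
    intro a b
    rw [hE, hE, ofTable_bracket_single]
    have : Finsupp.linearCombination ℂ E = Finsupp.lmapDomain ℂ ℂ ULift.up := by
      refine Finsupp.lhom_ext fun a c => ?_
      simp [hE, Finsupp.lmapDomain_apply]
    rw [this]
    rfl
  refine ⟨M, E, fun a => ?_, hbr, fun x y hy => ?_⟩
  · rw [hE]
    exact Finsupp.single_mem_supported ℂ _ rfl
  · have hy' : y ∈ Finsupp.supported ℂ ℂ {c | deg c = 1} := hy
    rw [Finsupp.supported_eq_span_single] at hy'
    refine (Submodule.span_le (p := LinearMap.ker (M.bracket x))).2 ?_ hy'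
    rintro _ ⟨⟨c⟩, hc, rfl⟩
    have hzero : M.rmul (E c) = 0 := E.ext fun a => by
      rw [rmul_apply, hbr]
      have hc' : c.deg = 1 := hc
      rcases c with _ | ⟨j, i⟩ | _ | j | j | ⟨j, i⟩
      on_goal 6 => cases a <;> simp [SNPIndex.table]
      all_goals exact absurd (show (0 : ZMod 2) = 1 from hc') zero_ne_one
    have := congr($hzero x)
    rwa [rmul_apply, hE] at this

/-- SNP is a competitor for the maximal dimension. -/
theorem finrank_le_of_isMaximal {L : ComplexSuperalgebra V} (hn : ∀ j, 0 < n j)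
    (hm : ∀ j, 0 < m j) (hL : L.IsMaximalSolvableWithNilradical (NP n m)) :
    Nat.card (NPIndex n m) + (1 + (k + p)) ≤ finrank ℂ V := by
  obtain ⟨M, E, h⟩ := exists_isSNPBasis.{u} n m
  have := hL.2 _ M (h.isSolvableWithNilradical hn hm)
  rwa [finrank_eq_nat_card_basis E, SNPIndex.card_eq] at this

theorem exists_isNPFrame {L : ComplexSuperalgebra V} {N : Submodule ℂ V}
    (h : (NP n m).IsomorphicToSub L N) :
    ∃ (e : NPIndex n m → V) (κ : V →ₗ[ℂ] ℂ), L.IsNPFrame N e κ := by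
  obtain ⟨f, hf, hinj, hrange⟩ := h
  let e : NPIndex n m → V := fun a => f (Finsupp.single a 1)
  have hfe : f = Finsupp.linearCombination ℂ e := by
    ext a
    simp [e]
  have hind : LinearIndependent ℂ e := by
    rwa [LinearIndependent, ← hfe]
  have hbr : ∀ a b, L.bracket (e a) (e b) = Finsupp.linearCombination ℂ e (a.table b) := by
    intro a b
    rw [← hfe, ← hf.map_bracket]
    exact congrArg f (ofTable_bracket_single _ _ _ a b)
  -- A left inverse extends the x₁ coefficient from N to all of V; the values off N depend on the
  -- choice.
  obtain ⟨g, hg⟩ := LinearMap.exists_leftInverse_of_injective f (LinearMap.ker_eq_bot.2 hinj)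
  have hge : ∀ a, g (e a) = Finsupp.single a 1 := fun a => congr($hg (Finsupp.single a 1))
  refine ⟨e, Finsupp.lapply .x1 ∘ₗ g, ?_⟩
  exact
  { indep := hind
    span_eq := by rw [← Finsupp.range_linearCombination, ← hfe, hrange]
    mem_part := fun a => hf.map_part _ _ (Finsupp.single_mem_supported ℂ _ rfl)
    bracket_x1_right := fun a => hbr a .x1
    bracket_x := fun a j i => by
      rw [hbr]
      cases a <;> simp [NPIndex.table]
    bracket_y := fun a j i => by
      rw [hbr]
      cases a <;> simp [NPIndex.table]
    κ_x1 := by simp [hge]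
    κ_x := fun j i => by simp [hge]
    κ_y := fun j i => by simp [hge] }

end ComplexSuperalgebra

theorem theorem6p1 {k p : ℕ} (hk : 1 ≤ k) (hp : 1 ≤ p) (n : Fin k → ℕ) (m : Fin p → ℕ)
    (hn : ∀ j, 2 ≤ n j) (hm : ∀ j, 2 ≤ m j)
    {V : Type u} [AddCommGroup V] [Module ℂ V] (L : ComplexSuperalgebra V)
    (hL : L.IsMaximalSolvableWithNilradical (NP n m)) :
    L.Isomorphic (SNP n m) := by
  have hn₀ : ∀ j, 0 < n j := fun j => two_pos.trans_le (hn j)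
  have hm₀ : ∀ j, 0 < m j := fun j => two_pos.trans_le (hm j)
  have hcard := ComplexSuperalgebra.finrank_le_of_isMaximal hn₀ hm₀ hL
  obtain ⟨⟨_, hleib, -, hsq, N, hN, hNP⟩, -⟩ := hL
  obtain ⟨e₀, κ, hf₀⟩ := ComplexSuperalgebra.exists_isNPFrame hNP
  have hext : L.IsNilradicalExtension N :=
    ⟨hleib, hN, fun x y => hN.largest _ L.isIdeal_square hsq (L.bracket_mem_square x y)⟩
  have hfin : finrank ℂ N = Nat.card (NPIndex n m) :=
    finrank_eq_nat_card_basis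
      ((Basis.span hf₀.indep).map (LinearEquiv.ofEq _ _ hf₀.span_eq))
  rw [← hfin] at hcard
  obtain ⟨e, μ, t, htp, hf, hμ, hμ₀, het⟩ := hf₀.exists_eigenframe hk hn hm hext hcard
  have ht : L.IsDiagonalizedBy e μ t := ⟨htp, hμ, hμ₀, het⟩
  have hT := hf.leftAnnihilator_le_even hk hn hext ht
  have hNT := hf.isCompl_leftAnnihilator hext ht
  choose χ hχ using hf.exists_right_weight hext ht
  choose c hc using hf.exists_left_weight hext ht
  have hw : L.IsWeightSystem e (L.leftAnnihilator t) χ c := ⟨hχ, hc⟩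
  have hinj := hw.generatorWeights_injective hf hn₀ hm₀ hext hT hNT.disjoint
  refine hw.isomorphic hf hk hn hm hext hT hNT
    (fun u hu v hv => hf.bracket_leftAnnihilator hext ht hu hv) ⟨hinj, ?_⟩
  -- Injectivity bounds dim T above by 1+k+p and maximality bounds it below, so the weight map is
  -- bijective.
  have hle := LinearMap.finrank_le_finrank_of_injective hinj
  refine (LinearMap.injective_iff_surjective_of_finrank_eq_finrank (le_antisymm hle ?_)).1 hinj
  have h1 := Submodule.finrank_add_eq_of_isCompl hNT
  have h2 : finrank ℂ (Unit ⊕ (Fin k ⊕ Fin p) → ℂ) = 1 + (k + p) := by simp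
  omega
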